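/- Let $P_T,\sigma>0$, $R\ge 0$, and let $\mathbf H\in\mathbb C^{N_R\times N_T}$ have rank $r\ge 2$ and reduced singular value decomposition $\mathbf H=\mathbf U\,\mathrm{diag}(\lambda_1,\dots,\lambda_r)\,\mathbf V^{\rm H}$, with $\mathbf U^{\rm H}\mathbf U=\mathbf V^{\rm H}\mathbf V=\mathbf I_r$, $\lambda_1\ge\dots\ge\lambda_r>0$, and let $\mathbf v_1$ be the first column of $\mathbf V$. Put $\mathbf M(\mathbf S,\rho)=\mathbf I+(1-\rho)\sigma^{-2}\mathbf H\mathbf S\mathbf H^{\rm H}$ and let $\mathcal{OP}1$ be the problem $$\max_{\rho,\mathbf S}\ \rho\,\mathrm{tr}(\mathbf H\mathbf S\mathbf H^{\rm H})\quad\text{s.t.}\quad \log_2\det\mathbf M(\mathbf S,\rho)\ge R,\quad \mathrm{tr}(\mathbf S)\le P_T,\quad \mathbf S\succeq 0,\quad 0\le\rho\le 1 .$$ Let $R_{\max}=\log_2\det(\mathbf I+\sigma^{-2}\mathbf H\mathbf V\,\mathrm{diag}(p_{{\rm WF},1},\dots,p_{{\rm WF},r})\mathbf V^{\rm H}\mathbf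 H^{\rm H})$, with the waterfilling powers $p_{{\rm WF},k}=\frac1{r_w}s_{r_w}+\frac{\sigma^2}{\lambda_{r_w}^2}-\frac{\sigma^2}{\lambda_k^2}$ for $k\le r_w$ and $p_{{\rm WF},k}=0$ for $k>r_w$, where $s_k=P_T-\sum_{i=1}^{k-1}\big(\frac{\sigma^2}{\lambda_k^2}-\frac{\sigma^2}{\lambda_i^2}\big)$ and $r_w=\max\{1\le k\le r: s_k>0\}$. For $p_1>0$, $p_2\ge 0$ let $$R_{\rm th}(p_1,p_2)=\log_2\left(1+\frac{p_2(\lambda_1^2-\lambda_2^2)}{\sigma^2}+\sqrt{\frac{(\lambda_1^2-\lambda_2^2)(\lambda_1^2p_1+\lambda_2^2p_2)^2}{\lambda_1^2\lambda_2^2\sigma^2p_1}}\right),$$ and let $R_{\rm th}=R_{\rm th}(P_T,0)$, the value at the allocation of the switching point. The KKT conditions of $\mathcal{OP}1$ at $(\mathbf S,\rho,\mu,\nu)$ are: feasibility; $\mu,\nu\ge0$; with $\mathbf G=\frac{\mu(1-\rho)}{\sigma^2\ln 2}\mathbf H^{\rm H}\mathbf M(\mathbf S,\rho)^{-1}\mathbf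 H+\rho\mathbf H^{\rm H}\mathbf H-\nu\mathbf I$, that $\mathbf G\preceq 0$ and $\mathbf G\mathbf S=0$; $\mathrm{tr}(\mathbf H\mathbf S\mathbf H^{\rm H})=\mu\,\mathrm{tr}\big(\tfrac{\mathbf H\mathbf S\mathbf H^{\rm H}}{\sigma^2\ln2}\mathbf M(\mathbf S,\rho)^{-1}\big)$; $\mu\,(R-\log_2\det\mathbf M(\mathbf S,\rho))=0$; $\nu\,(\mathrm{tr}(\mathbf S)-P_T)=0$. Then the following hold. 1. (Energy beamforming.) If $R\le R_{\rm th}$ and $R\le R_{\max}$, then $(\mathbf S^*,\rho^*)=(P_T\mathbf v_1\mathbf v_1^{\rm H},\rho_{\rm EB})$ with $\rho_{\rm EB}=\max\{0,1-\frac{(2^R-1)\sigma^2}{P_T\lambda_1^2}\}$ is a global optimum of $\mathcal{OP}1$, and it is the only one if $\lambda_1>\lambda_2$. Moreover $(\mathbf S^*,\rho^*,\mu,\nu)$ satisfies the KKT conditions if and only if $\mu=\mu_{\rm EB}=\sigma^2\ln2\,\big(1+\frac{(1-\rho_{\rm EB})P_T\lambda_1^2}{\sigma^2}\big)$ and $\nu=\nu_{\rm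 EB}=\frac{\mu_{\rm EB}(1-\rho_{\rm EB})\lambda_1^2}{\ln2\,(\sigma^2+(1-\rho_{\rm EB})P_T\lambda_1^2)}+\lambda_1^2\rho_{\rm EB}$. 2. (Spatial multiplexing.) If $R_{\rm th}<R\le R_{\max}$, then there is exactly one triple $(\rho^*,\mu^*,\nu^*)$ with $0\le\rho^*<1$, $\mu^*,\nu^*>0$ and $\nu^*>\rho^*\lambda_k^2$ for all $k$ such that, with $$p_k^*=\left(\frac{\mu^*}{\ln2\,(\nu^*-\rho^*\lambda_k^2)}-\frac{\sigma^2}{(1-\rho^*)\lambda_k^2}\right)^+,\qquad \mathbf S^*=\mathbf V\,\mathrm{diag}(p_1^*,\dots,p_r^*)\,\mathbf V^{\rm H},$$ the three equations $$\mu^*\big(R-\log_2\det\mathbf M(\mathbf S^*,\rho^*)\big)=0,\quad \nu^*\big(\mathrm{tr}(\mathbf S^*)-P_T\big)=0,\quad \mu^*=\frac{\mathrm{tr}(\mathbf H\mathbf S^*\mathbf H^{\rm H})}{\mathrm{tr}\big(\frac{\mathbf H\mathbf S^*\mathbf H^{\rm H}}{\sigma^2\ln2}\mathbf M(\mathbf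 S^*,\rho^*)^{-1}\big)}$$ hold. For this triple, $(\mathbf S^*,\rho^*)$ is the unique global optimum of $\mathcal{OP}1$, $(\mathbf S^*,\rho^*,\mu^*,\nu^*)$ satisfies the KKT conditions, and $p_2^*>0$. 3. If $R>R_{\max}$, then $\mathcal{OP}1$ is infeasible. -/

import Mathlib

open scoped Matrix ComplexOrder

namespace SWIPT

/-- Reduced singular value decomposition `H = U Λ Vᴴ`: the columns of `U` and of `V` are
orthonormal and `Λ = diag lam` carries the non-zero singular values in decreasing order. -/
structure IsReducedSVD {NR NT r : ℕ} (H : Matrix (Fin NR) (Fin NT) ℂ)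
    (U : Matrix (Fin NR) (Fin r) ℂ) (lam : Fin r → ℝ) (V : Matrix (Fin NT) (Fin r) ℂ) : Prop where
  U_orth : Uᴴ * U = 1
  V_orth : Vᴴ * V = 1
  pos : ∀ k, 0 < lam k
  anti : Antitone lam
  eq : H = U * Matrix.diagonal (fun k => (lam k : ℂ)) * Vᴴ

/-- The received covariance `H S Hᴴ`. -/
noncomputable def recvCov {NR NT : ℕ} (H : Matrix (Fin NR) (Fin NT) ℂ)
    (S : Matrix (Fin NT) (Fin NT) ℂ) : Matrix (Fin NR) (Fin NR) ℂ :=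
  H * S * Hᴴ

/-- `tr (H S Hᴴ)`, a real number when `S` is Hermitian. -/
noncomputable def recvPower {NR NT : ℕ} (H : Matrix (Fin NR) (Fin NT) ℂ)
    (S : Matrix (Fin NT) (Fin NT) ℂ) : ℝ :=
  (recvCov H S).trace.re

/-- `I + (1 - ρ) σ⁻² H S Hᴴ`. -/
noncomputable def infoMat {NR NT : ℕ} (H : Matrix (Fin NR) (Fin NT) ℂ) (σ : ℝ)
    (S : Matrix (Fin NT) (Fin NT) ℂ) (ρ : ℝ) : Matrix (Fin NR) (Fin NR) ℂ :=
  1 + (((1 - ρ) / σ ^ 2 : ℝ) : ℂ) • recvCov H S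

/-- The information rate `log₂ det (I + (1 - ρ) σ⁻² H S Hᴴ)`; the determinant is real and
positive for `S ⪰ 0` and `ρ ≤ 1`. -/
noncomputable def rate {NR NT : ℕ} (H : Matrix (Fin NR) (Fin NT) ℂ) (σ : ℝ)
    (S : Matrix (Fin NT) (Fin NT) ℂ) (ρ : ℝ) : ℝ :=
  Real.logb 2 (infoMat H σ S ρ).det.re

/-- The objective of OP1: the received power `ρ tr (H S Hᴴ)` available for harvesting. -/
noncomputable def harvest {NR NT : ℕ} (H : Matrix (Fin NR) (Fin NT) ℂ)
    (S : Matrix (Fin NT) (Fin NT) ℂ) (ρ : ℝ) : ℝ :=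
  ρ * recvPower H S

/-- The constraints (C1)–(C4) of OP1. -/
structure Feasible {NR NT : ℕ} (H : Matrix (Fin NR) (Fin NT) ℂ) (P σ R : ℝ)
    (S : Matrix (Fin NT) (Fin NT) ℂ) (ρ : ℝ) : Prop where
  rate_ge : R ≤ rate H σ S ρ
  power_le : S.trace.re ≤ P
  psd : S.PosSemidef
  ratio_mem : 0 ≤ ρ ∧ ρ ≤ 1

/-- `(S, ρ)` is a global maximizer of OP1. -/
def IsGlobalOptimum {NR NT : ℕ} (H : Matrix (Fin NR) (Fin NT) ℂ) (P σ R : ℝ)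
    (S : Matrix (Fin NT) (Fin NT) ℂ) (ρ : ℝ) : Prop :=
  Feasible H P σ R S ρ ∧
    ∀ (S' : Matrix (Fin NT) (Fin NT) ℂ) (ρ' : ℝ),
      Feasible H P σ R S' ρ' → harvest H S' ρ' ≤ harvest H S ρ

/-- `∂L/∂S`, where `L = ρ tr(H S Hᴴ) - ν (tr S - P) - μ (R - log₂ det(I + (1-ρ) σ⁻² H S Hᴴ))` is
the Lagrangian of OP1. -/
noncomputable def gradS {NR NT : ℕ} (H : Matrix (Fin NR) (Fin NT) ℂ) (σ : ℝ)
    (S : Matrix (Fin NT) (Fin NT) ℂ) (ρ μ ν : ℝ) : Matrix (Fin NT) (Fin NT) ℂ :=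
  ((μ * (1 - ρ) / (σ ^ 2 * Real.log 2) : ℝ) : ℂ) • (Hᴴ * (infoMat H σ S ρ)⁻¹ * H)
    + (ρ : ℂ) • (Hᴴ * H) - (ν : ℂ) • (1 : Matrix (Fin NT) (Fin NT) ℂ)

/-- `tr ((H S Hᴴ / (σ² ln 2)) (I + (1 - ρ) σ⁻² H S Hᴴ)⁻¹)`, which is minus the derivative of the
rate in `ρ`. -/
noncomputable def rateSlope {NR NT : ℕ} (H : Matrix (Fin NR) (Fin NT) ℂ) (σ : ℝ)
    (S : Matrix (Fin NT) (Fin NT) ℂ) (ρ : ℝ) : ℝ :=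
  (((1 / (σ ^ 2 * Real.log 2) : ℝ) : ℂ) • (recvCov H S * (infoMat H σ S ρ)⁻¹)).trace.re

/-- The KKT conditions of OP1 at `(S, ρ)` with multipliers `μ` for the rate constraint and `ν` for
the power constraint. Stationarity in `S` is taken relative to the cone `S ⪰ 0`:
`-∂L/∂S ⪰ 0` is the multiplier of that constraint and `(∂L/∂S) S = 0` is its complementary
slackness. -/
structure IsKKTPoint {NR NT : ℕ} (H : Matrix (Fin NR) (Fin NT) ℂ) (P σ R : ℝ)
    (S : Matrix (Fin NT) (Fin NT) ℂ) (ρ μ ν : ℝ) : Prop where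
  feasible : Feasible H P σ R S ρ
  mu_nonneg : 0 ≤ μ
  nu_nonneg : 0 ≤ ν
  stat_S : (-gradS H σ S ρ μ ν).PosSemidef
  slack_S : gradS H σ S ρ μ ν * S = 0
  stat_ρ : -μ * rateSlope H σ S ρ + recvPower H S = 0
  slack_rate : μ * (R - rate H σ S ρ) = 0
  slack_power : ν * (S.trace.re - P) = 0

/-- The covariance `V diag(p) Vᴴ` allocating power `p k` to the `k`-th eigenchannel. -/
noncomputable def covOfPowers {NT r : ℕ} (V : Matrix (Fin NT) (Fin r) ℂ) (p : Fin r → ℝ) :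
    Matrix (Fin NT) (Fin NT) ℂ :=
  V * Matrix.diagonal (fun k => (p k : ℂ)) * Vᴴ

/-! ### Energy beamforming -/

/-- `S_EB = P v vᴴ`. -/
noncomputable def covEB {NT : ℕ} (v : Fin NT → ℂ) (P : ℝ) : Matrix (Fin NT) (Fin NT) ℂ :=
  (P : ℂ) • Matrix.vecMulVec v (star v)

/-- `ρ_EB`, with `l1` the largest singular value. -/
noncomputable def ratioEB (l1 P σ R : ℝ) : ℝ :=
  max 0 (1 - ((2 : ℝ) ^ R - 1) * σ ^ 2 / (P * l1 ^ 2))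

noncomputable def muEB (l1 P σ R : ℝ) : ℝ :=
  σ ^ 2 * Real.log 2 * (1 + (1 - ratioEB l1 P σ R) * P * l1 ^ 2 / σ ^ 2)

noncomputable def nuEB (l1 P σ R : ℝ) : ℝ :=
  muEB l1 P σ R * (1 - ratioEB l1 P σ R) * l1 ^ 2 /
      (Real.log 2 * (σ ^ 2 + (1 - ratioEB l1 P σ R) * P * l1 ^ 2))
    + l1 ^ 2 * ratioEB l1 P σ R

/-- The rate at which energy beamforming and multiplexing with powers `p1`, `p2` over the two
strongest eigenchannels (singular values `l1`, `l2`) harvest the same power, as a function of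
the allocation. -/
noncomputable def rateThresholdAt (l1 l2 σ p1 p2 : ℝ) : ℝ :=
  Real.logb 2 (1 + p2 * (l1 ^ 2 - l2 ^ 2) / σ ^ 2
    + Real.sqrt ((l1 ^ 2 - l2 ^ 2) * (l1 ^ 2 * p1 + p2 * l2 ^ 2) ^ 2 /
        (l1 ^ 2 * l2 ^ 2 * σ ^ 2 * p1)))

/-- The rate threshold `R_th`: the above at the allocation of the switching point, where the
second eigenchannel is about to be used, `p1 = P` and `p2 = 0`. -/
noncomputable def rateThreshold (l1 l2 P σ : ℝ) : ℝ :=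
  rateThresholdAt l1 l2 σ P 0

/-! ### Waterfilling and the maximal rate -/

/-- `σ² / λ_k²` with eigenchannels numbered `k = 1, …, r`. -/
noncomputable def noiseGain {r : ℕ} (lam : Fin r → ℝ) (σ : ℝ) (k : ℕ) : ℝ :=
  if h : k - 1 < r then σ ^ 2 / lam ⟨k - 1, h⟩ ^ 2 else 0

/-- `P - ∑_{i=1}^{k-1} (σ²/λ_k² - σ²/λ_i²)`. -/
noncomputable def wfSlack {r : ℕ} (lam : Fin r → ℝ) (P σ : ℝ) (k : ℕ) : ℝ :=
  P - ∑ i ∈ Finset.Ico 1 k, (noiseGain lam σ k - noiseGain lam σ i)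

/-- The number `r_w` of eigenchannels used by waterfilling. -/
noncomputable def wfRank {r : ℕ} (lam : Fin r → ℝ) (P σ : ℝ) : ℕ :=
  sSup {k : ℕ | 0 < max 0 (wfSlack lam P σ k) ∧ 1 ≤ k ∧ k ≤ r}

/-- The waterfilling powers; the index `k : Fin r` stands for eigenchannel number `k + 1`. -/
noncomputable def wfPower {r : ℕ} (lam : Fin r → ℝ) (P σ : ℝ) (k : Fin r) : ℝ :=
  if (k : ℕ) + 1 ≤ wfRank lam P σ then
    wfSlack lam P σ (wfRank lam P σ) / (wfRank lam P σ : ℝ)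
      + noiseGain lam σ (wfRank lam P σ) - noiseGain lam σ ((k : ℕ) + 1)
  else 0

/-- `R_max = log₂ det (I + σ⁻² H S_WF Hᴴ)` with `S_WF = V diag(p_WF) Vᴴ`. -/
noncomputable def rateMax {NR NT r : ℕ} (H : Matrix (Fin NR) (Fin NT) ℂ) (lam : Fin r → ℝ)
    (V : Matrix (Fin NT) (Fin r) ℂ) (P σ : ℝ) : ℝ :=
  rate H σ (covOfPowers V (wfPower lam P σ)) 0

/-! ### Spatial multiplexing -/

/-- The modified waterfilling powers. -/
noncomputable def powerSM {r : ℕ} (lam : Fin r → ℝ) (σ ρ μ ν : ℝ) (k : Fin r) : ℝ :=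
  max 0 (μ / (Real.log 2 * (ν - ρ * lam k ^ 2)) - σ ^ 2 / ((1 - ρ) * lam k ^ 2))

noncomputable def covSM {NT r : ℕ} (lam : Fin r → ℝ) (V : Matrix (Fin NT) (Fin r) ℂ)
    (σ ρ μ ν : ℝ) : Matrix (Fin NT) (Fin NT) ℂ :=
  covOfPowers V (powerSM lam σ ρ μ ν)

/-- The system of three equations for `(ρ, μ, ν)` (complementary slackness of the rate and power
constraints and stationarity in `ρ`, with `S = V diag(powerSM) Vᴴ` substituted), over the range
`0 ≤ ρ < 1`, `μ, ν > 0`, `ν > ρ λ_k²` in which the water levels are positive. -/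
structure SolvesSystem {NR NT r : ℕ} (H : Matrix (Fin NR) (Fin NT) ℂ) (lam : Fin r → ℝ)
    (V : Matrix (Fin NT) (Fin r) ℂ) (P σ R ρ μ ν : ℝ) : Prop where
  ratio_mem : 0 ≤ ρ ∧ ρ < 1
  mu_pos : 0 < μ
  nu_pos : 0 < ν
  level_pos : ∀ k, ρ * lam k ^ 2 < ν
  slack_rate : μ * (R - rate H σ (covSM lam V σ ρ μ ν) ρ) = 0
  slack_power : ν * ((covSM lam V σ ρ μ ν).trace.re - P) = 0
  stat_ρ : μ = recvPower H (covSM lam V σ ρ μ ν) / rateSlope H σ (covSM lam V σ ρ μ ν) ρ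

end SWIPT

open SWIPT

/-!
Conjugating by the singular vectors, with `b k = σ² / λ_k²`, `x = 1 - ρ` and the signal-to-noise
ratios `d k = x p_k / b k` as variables, OP1 for independent eigenchannels becomes: maximize
`(1 - x) / x * ∑ d` subject to `∑ log (1 + d) ≥ R log 2` and `∑ b d ≤ x P`. Hadamard's inequality
(`det_re_le_prod_diag`, used in `rate_le`) shows that general covariances do no better, and its
equality case, together with the equality case of `tr (Vᴴ S V) ≤ tr S` (`sum_channelPower_le`),
carries uniqueness of the scalar optimum back to matrices.

OP1 is not a convex problem, but the scalar problem is quasi-concave: for fixed `d` the best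
splitting is `x = ∑ b d / P`, and then the objective is at least `t` exactly when
`∑ b d ≤ P D / (t + D)`, `D = ∑ d`, a convex constraint. Hence the first-order conditions are
sufficient, and strict concavity of the logarithm gives uniqueness. Concretely
(`IsWaterLevel.harvest_le`), a point with `1 + d k = max 1 (1 / (α b k - β))` maximizes
`∑ log (1 + d) - α ∑ b d + β D`, so that every competitor of the same rate satisfies
`β (D' - D) ≤ α (s' - s)`, `s = ∑ b d`; when moreover `P β D = α s (P - s)`, comparing objectives
reduces to `(s' - s)² ≥ 0`. `IsStationary` states these conditions in the original variables; its
points are optimal, uniquely so, and satisfy the KKT conditions.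

It remains to find such points.

* The triples `(ρ, μ, ν)` solving the system of three equations are exactly the stationary points
  (`IsStationary.solvesSystem`, `SolvesSystem.exists_isStationary`). One exists at every rate
  `0 < R ≤ R_max` (`exists_isWaterLevel`, `exists_isStationary`): on the curve of pairs `(α, β)`
  with rate `R`, the condition `P β D = α s (P - s)` holds somewhere between `β = 0`, which is
  the allocation of least power and fits into `P` because `R ≤ R_max`, and large `β`.
* Energy beamforming is stationary exactly when the water level of the second channel is at least
  `1`, and this inequality is `R ≤ R_th` (`le_rateThreshold_iff_of_mul_eq`); so the second channel
  is in use above the threshold. At `R = 0` nothing is spent on information and the optimality of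
  beamforming is direct (`isGlobalOptimum_zero_rate`).
* Waterfilling is the water level with `β = 0` at full power, so it has the largest rate
  (`Feasible.le_rateMax`).
-/

namespace SWIPT

/-! ### Water levels -/

section Scalar

variable {ι : Type*}

/-- `d` is the vector of signal-to-noise ratios belonging to the affine water level `α b - β`:
`1 + d k` is the reciprocal of `α b k - β` where that exceeds `1`, and `1` elsewhere. -/
structure IsWaterLevel (b : ι → ℝ) (α β : ℝ) (d : ι → ℝ) : Prop where
  nonneg : ∀ k, 0 ≤ d k
  le : ∀ k, (1 + d k)⁻¹ ≤ α * b k - β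
  eq : ∀ k, d k ≠ 0 → (1 + d k)⁻¹ = α * b k - β

lemma isWaterLevel_of_pos {b : ι → ℝ} {α β : ℝ} (hpos : ∀ k, 0 < α * b k - β) :
    IsWaterLevel b α β (fun k => (min 1 (α * b k - β))⁻¹ - 1) where
  nonneg k := by
    have : 1 ≤ (min 1 (α * b k - β))⁻¹ :=
      (one_le_inv₀ (lt_min one_pos (hpos k))).2 (min_le_left _ _)
    linarith
  le k := by
    rw [add_sub_cancel, inv_inv]
    exact min_le_right _ _
  eq k hk := by
    rw [add_sub_cancel, inv_inv]
    rcases min_choice 1 (α * b k - β) with h | h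
    · exact absurd (by rw [h]; simp) hk
    · exact h

lemma log_one_add_lt_tangent {s t : ℝ} (hs : 0 ≤ s) (ht : 0 ≤ t) (h : t ≠ s) :
    Real.log (1 + t) < Real.log (1 + s) + (t - s) * (1 + s)⁻¹ := by
  have h1 : (1 + t) / (1 + s) ≠ 1 := by
    rw [Ne, div_eq_one_iff_eq (by positivity)]
    intro h2
    exact h (by linarith)
  have h2 := Real.log_lt_sub_one_of_pos (x := (1 + t) / (1 + s)) (by positivity) h1
  rw [Real.log_div (by positivity) (by positivity)] at h2
  have h3 : (1 + t) / (1 + s) - 1 = (t - s) * (1 + s)⁻¹ := by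
    have : 1 + s ≠ 0 := by positivity
    field_simp
    ring
  linarith

namespace IsWaterLevel

variable {b d e : ι → ℝ} {α β : ℝ}

lemma pos (h : IsWaterLevel b α β d) (k : ι) : 0 < α * b k - β :=
  lt_of_lt_of_le (inv_pos.2 (by linarith [h.nonneg k])) (h.le k)

lemma mul_inv (h : IsWaterLevel b α β d) (k : ι) :
    d k * (1 + d k)⁻¹ = d k * (α * b k - β) := by
  by_cases hk : d k = 0
  · simp [hk]
  · rw [h.eq k hk]

lemma log_lt (h : IsWaterLevel b α β d) {t : ℝ} (ht : 0 ≤ t) (k : ι) (hne : t ≠ d k) :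
    Real.log (1 + t) < Real.log (1 + d k) + (t - d k) * (α * b k - β) := by
  have h1 := log_one_add_lt_tangent (h.nonneg k) ht hne
  have h2 : t * (1 + d k)⁻¹ ≤ t * (α * b k - β) := mul_le_mul_of_nonneg_left (h.le k) ht
  have h3 := h.mul_inv k
  linarith [sub_mul t (d k) ((1 + d k)⁻¹), sub_mul t (d k) (α * b k - β)]

lemma log_le (h : IsWaterLevel b α β d) {t : ℝ} (ht : 0 ≤ t) (k : ι) :
    Real.log (1 + t) ≤ Real.log (1 + d k) + (t - d k) * (α * b k - β) := by
  by_cases hne : t = d k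
  · simp [hne]
  · exact (h.log_lt ht k hne).le

variable [Fintype ι]

lemma sum_expand :
    ∑ k, (Real.log (1 + d k) + (e k - d k) * (α * b k - β))
      = ∑ k, Real.log (1 + d k) + α * (∑ k, b k * e k - ∑ k, b k * d k)
        - β * (∑ k, e k - ∑ k, d k) := by
  simp only [mul_sub, Finset.mul_sum, ← Finset.sum_sub_distrib, ← Finset.sum_add_distrib]
  exact Finset.sum_congr rfl fun k _ => by ring

/-- By concavity of the logarithm, the SNRs of a water level maximize the Lagrangian
`∑ log (1 + e) - α ∑ b e + β ∑ e` over `e ≥ 0`. -/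
lemma sum_log_le (h : IsWaterLevel b α β d) (he : ∀ k, 0 ≤ e k) :
    ∑ k, Real.log (1 + e k) ≤ ∑ k, Real.log (1 + d k)
      + α * (∑ k, b k * e k - ∑ k, b k * d k) - β * (∑ k, e k - ∑ k, d k) := by
  rw [← sum_expand]
  exact Finset.sum_le_sum fun k _ => h.log_le (he k) k

/-- By strict concavity, the maximizer of the Lagrangian is unique. -/
lemma sum_log_lt (h : IsWaterLevel b α β d) (he : ∀ k, 0 ≤ e k) (hne : e ≠ d) :
    ∑ k, Real.log (1 + e k) < ∑ k, Real.log (1 + d k)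
      + α * (∑ k, b k * e k - ∑ k, b k * d k) - β * (∑ k, e k - ∑ k, d k) := by
  rw [← sum_expand]
  obtain ⟨k, hk⟩ := Function.ne_iff.1 hne
  exact Finset.sum_lt_sum (fun k _ => h.log_le (he k) k)
    ⟨k, Finset.mem_univ k, h.log_lt (he k) k hk⟩

lemma sum_div (h : IsWaterLevel b α β d) :
    ∑ k, d k / (1 + d k) = α * ∑ k, b k * d k - β * ∑ k, d k := by
  simp only [Finset.mul_sum, ← Finset.sum_sub_distrib]
  refine Finset.sum_congr rfl fun k _ => ?_
  rw [div_eq_mul_inv, h.mul_inv k]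
  ring

end IsWaterLevel

variable [Fintype ι]

lemma sum_log_nonpos_of_sum_nonpos {e : ι → ℝ} (he : ∀ k, 0 ≤ e k) (h : ∑ k, e k ≤ 0) :
    ∑ k, Real.log (1 + e k) ≤ 0 := by
  have h0 : ∀ k, e k = 0 := fun k =>
    le_antisymm ((Finset.single_le_sum (fun i _ => he i) (Finset.mem_univ k)).trans h) (he k)
  simp [h0]

/-- Sufficiency of the first-order conditions. A water level whose parameters satisfy
`P β D = α s (P - s)`, with `s = ∑ b d` and `D = ∑ d`, maximizes the harvested power
`(1 - x) / x * ∑ e` among all splittings `x` and SNRs `e` of at least the same rate. -/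
theorem IsWaterLevel.harvest_le {b d e : ι → ℝ} {α β P x : ℝ} (h : IsWaterLevel b α β d)
    (hb : ∀ k, 0 < b k) (hβ : 0 ≤ β) (hα : 0 < α)
    (hT : 0 < ∑ k, Real.log (1 + d k)) (hP : 0 < P) (hsP : ∑ k, b k * d k ≤ P)
    (hst : P * β * ∑ k, d k = α * (∑ k, b k * d k) * (P - ∑ k, b k * d k))
    (he : ∀ k, 0 ≤ e k) (hx0 : 0 < x) (hx1 : x ≤ 1) (hse : ∑ k, b k * e k ≤ x * P)
    (hTe : ∑ k, Real.log (1 + d k) ≤ ∑ k, Real.log (1 + e k)) :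
    (1 - x) / x * ∑ k, e k ≤ (P - ∑ k, b k * d k) / (∑ k, b k * d k) * ∑ k, d k ∧
      ((P - ∑ k, b k * d k) / (∑ k, b k * d k) * ∑ k, d k ≤ (1 - x) / x * ∑ k, e k →
        e = d ∧ x = (∑ k, b k * d k) / P) := by
  have hD : 0 < ∑ k, d k := by
    by_contra hc
    exact absurd (sum_log_nonpos_of_sum_nonpos h.nonneg (not_lt.1 hc)) (not_le.2 hT)
  have hE : 0 < ∑ k, e k := by
    by_contra hc
    exact absurd (sum_log_nonpos_of_sum_nonpos he (not_lt.1 hc)) (not_le.2 (hT.trans_le hTe))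
  have hpos : ∀ f : ι → ℝ, (∀ k, 0 ≤ f k) → 0 < ∑ k, f k → 0 < ∑ k, b k * f k := by
    intro f hf hsum
    obtain ⟨k, _, hk⟩ := Finset.exists_lt_of_sum_lt (s := Finset.univ) (f := fun _ => (0 : ℝ))
      (g := f) (by simpa using hsum)
    exact Finset.sum_pos' (fun i _ => mul_nonneg (hb i).le (hf i))
      ⟨k, Finset.mem_univ k, mul_pos (hb k) hk⟩
  have hs := hpos d h.nonneg hD
  have ht := hpos e he hE
  have hle := h.sum_log_le he
  have hlt := fun hne => h.sum_log_lt he hne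
  set s := ∑ k, b k * d k with hsdef
  set D := ∑ k, d k
  set t := ∑ k, b k * e k
  set E := ∑ k, e k
  have htP : t ≤ P := hse.trans (by nlinarith)
  -- given `e`, the smallest admissible `x` is `t / P`
  have hstep : (1 - x) / x * E ≤ (P - t) / t * E := by
    refine mul_le_mul_of_nonneg_right ?_ hE.le
    rw [div_le_div_iff₀ hx0 ht]
    nlinarith
  have key : β * (E - D) ≤ α * (t - s) := by linarith
  -- `(P - t) / t * E ≤ (P - s) / s * D`; for `β > 0` this amounts to `(t - s) ^ 2 ≥ 0`
  have hmain : (P - t) / t * E ≤ (P - s) / s * D := by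
    rw [div_mul_eq_mul_div, div_mul_eq_mul_div, div_le_div_iff₀ ht hs]
    rcases hβ.eq_or_lt with h0 | hβ
    · subst h0
      have h1 : P - s = 0 := by
        have : α * s * (P - s) = 0 := by linarith
        rcases mul_eq_zero.1 this with h2 | h2
        · exact absurd h2 (by positivity)
        · exact h2
      have h2 : s ≤ t := by nlinarith
      have h3 : P - t = 0 := by linarith
      simp [h1, h3]
    · have hc : 0 < P * β := by positivity
      refine le_of_mul_le_mul_left ?_ hc
      have h1 : P * (P - t) * s * (β * (E - D)) ≤ P * (P - t) * s * (α * (t - s)) :=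
        mul_le_mul_of_nonneg_left key
          (mul_nonneg (mul_nonneg hP.le (by linarith)) hs.le)
      have h2 : 0 ≤ α * s * (t - s) ^ 2 * P := by positivity
      have h3 : P * β * D * ((P - s) * t - (P - t) * s)
          = α * s * (P - s) * ((P - s) * t - (P - t) * s) := by rw [hst]
      nlinarith
  refine ⟨hstep.trans hmain, fun hge => ?_⟩
  have e1 : (1 - x) / x * E = (P - t) / t * E :=
    le_antisymm hstep (hmain.trans hge)
  have e2 : (P - t) / t * E = (P - s) / s * D :=
    le_antisymm hmain (hge.trans hstep)
  have hxt : x = t / P := by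
    have := mul_right_cancel₀ hE.ne' e1
    rw [div_eq_div_iff hx0.ne' ht.ne'] at this
    rw [eq_div_iff hP.ne']
    linarith
  suffices hed : e = d by
    refine ⟨hed, ?_⟩
    rw [hxt]
    simp [t, hed, hsdef]
  by_contra hne
  have keylt : β * (E - D) < α * (t - s) := by linarith [hlt hne]
  rcases hβ.eq_or_lt with h0 | hβ
  · subst h0
    have h1 : P - s = 0 := by
      have : α * s * (P - s) = 0 := by linarith
      rcases mul_eq_zero.1 this with h2 | h2
      · exact absurd h2 (by positivity)
      · exact h2
    have h2 : 0 < t - s := by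
      by_contra hc
      nlinarith
    linarith
  · rw [div_mul_eq_mul_div, div_mul_eq_mul_div, div_eq_div_iff ht.ne' hs.ne'] at e2
    have hsltP : s < P := by
      by_contra hc
      have h1 : P - s = 0 := by linarith
      rw [h1] at hst
      have : 0 < P * β * D := by positivity
      linarith
    have htltP : t < P := by
      have : 0 < (P - s) * D * t := mul_pos (mul_pos (by linarith) hD) ht
      by_contra hc
      have h1 : P - t = 0 := by linarith
      rw [h1] at e2
      linarith
    have h1 : P * (P - t) * s * (β * (E - D)) < P * (P - t) * s * (α * (t - s)) :=
      mul_lt_mul_of_pos_left keylt (mul_pos (mul_pos hP (by linarith)) hs)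
    have h2 : 0 ≤ α * s * (t - s) ^ 2 * P := by positivity
    have h3 : P * β * D * ((P - s) * t - (P - t) * s)
        = α * s * (P - s) * ((P - s) * t - (P - t) * s) := by rw [hst]
    have h4 : P * β * ((P - t) * E * s) = P * β * ((P - s) * D * t) := by rw [e2]
    nlinarith

/-! ### Existence of the multiplexing water level -/

/-- Intermediate value theorem along the level set `Φ = T`, which is the graph of a function of
the first coordinate; no regularity of that function is needed. -/
lemma exists_eq_on_level {B lo hi T : ℝ} (hB : 0 ≤ B) (Φ g : ℝ × ℝ → ℝ)
    (hΦ : ContinuousOn Φ (Set.Icc 0 B ×ˢ Set.Icc lo hi))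
    (hg : ContinuousOn g (Set.Icc 0 B ×ˢ Set.Icc lo hi))
    (hex : ∀ β ∈ Set.Icc 0 B, ∃ c ∈ Set.Icc lo hi, Φ (β, c) = T)
    (huniq : ∀ β ∈ Set.Icc 0 B, ∀ c ∈ Set.Icc lo hi, ∀ c' ∈ Set.Icc lo hi,
      Φ (β, c) = T → Φ (β, c') = T → c = c')
    (h0 : ∀ c ∈ Set.Icc lo hi, Φ (0, c) = T → g (0, c) ≤ 0)
    (h1 : ∀ c ∈ Set.Icc lo hi, Φ (B, c) = T → 0 ≤ g (B, c)) :
    ∃ β ∈ Set.Icc 0 B, ∃ c ∈ Set.Icc lo hi, Φ (β, c) = T ∧ g (β, c) = 0 := by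
  have hK : IsCompact (Set.Icc 0 B ×ˢ Set.Icc lo hi) := isCompact_Icc.prod isCompact_Icc
  have hcl : ∀ s : Set ℝ, IsClosed s → IsClosed (Prod.fst ''
      ((Set.Icc 0 B ×ˢ Set.Icc lo hi) ∩ (fun q => (Φ q, g q)) ⁻¹' ({T} ×ˢ s))) := fun s hs =>
    ((hK.of_isClosed_subset
      ((hΦ.prodMk hg).preimage_isClosed_of_isClosed hK.isClosed (isClosed_singleton.prod hs))
      Set.inter_subset_left).image continuous_fst).isClosed
  have hpre := (isPreconnected_closed_iff.1 (isPreconnected_Icc : IsPreconnected (Set.Icc 0 B)))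
    _ _ (hcl (Set.Iic 0) isClosed_Iic) (hcl (Set.Ici 0) isClosed_Ici) ?_ ?_ ?_
  · obtain ⟨β, hβ, ⟨⟨β1, c⟩, ⟨hm, hc⟩, rfl⟩, ⟨⟨β2, c'⟩, ⟨hm', hc'⟩, h2⟩⟩ := hpre
    simp only [Set.mem_preimage, Set.mem_prod, Set.mem_singleton_iff, Set.mem_Iic,
      Set.mem_Ici] at hm hc hm' hc' h2
    subst h2
    obtain rfl := huniq _ hβ c hm.2 c' hm'.2 hc.1 hc'.1
    exact ⟨_, hβ, c, hm.2, hc.1, le_antisymm hc.2 hc'.2⟩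
  · intro β hβ
    obtain ⟨c, hc, hΦc⟩ := hex β hβ
    rcases le_total (g (β, c)) 0 with h | h
    · exact Or.inl ⟨(β, c), ⟨⟨hβ, hc⟩, hΦc, h⟩, rfl⟩
    · exact Or.inr ⟨(β, c), ⟨⟨hβ, hc⟩, hΦc, h⟩, rfl⟩
  · have hβ : (0 : ℝ) ∈ Set.Icc 0 B := ⟨le_rfl, hB⟩
    obtain ⟨c, hc, hΦc⟩ := hex 0 hβ
    exact ⟨0, hβ, (0, c), ⟨⟨hβ, hc⟩, hΦc, h0 c hc hΦc⟩, rfl⟩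
  · have hβ : B ∈ Set.Icc 0 B := ⟨hB, le_rfl⟩
    obtain ⟨c, hc, hΦc⟩ := hex B hβ
    exact ⟨B, hβ, (B, c), ⟨⟨hβ, hc⟩, hΦc, h1 c hc hΦc⟩, rfl⟩

/-- A rate `T > 0` that is attainable with power `P` is attained by a water level satisfying the
condition of `IsWaterLevel.harvest_le`. -/
theorem exists_isWaterLevel {b : ι → ℝ} (hb : ∀ k, 0 < b k) (i : ι) (hi : ∀ k, b i ≤ b k)
    {P T : ℝ} (hP : 0 < P) (hT : 0 < T) {e : ι → ℝ} (he : ∀ k, 0 ≤ e k)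
    (heP : ∑ k, b k * e k ≤ P) (heT : T ≤ ∑ k, Real.log (1 + e k)) :
    ∃ (α β : ℝ) (d : ι → ℝ), 0 < α ∧ 0 ≤ β ∧ IsWaterLevel b α β d ∧
      ∑ k, Real.log (1 + d k) = T ∧ ∑ k, b k * d k ≤ P ∧
      P * β * ∑ k, d k = α * (∑ k, b k * d k) * (P - ∑ k, b k * d k) := by
  -- the pair `(β, c)` stands for the water level with `α * b i - β = c`
  let z : ℝ × ℝ → ι → ℝ := fun q k => (q.1 + q.2) / b i * b k - q.1
  let δ : ℝ × ℝ → ι → ℝ := fun q k => (min 1 (z q k))⁻¹ - 1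
  have hzi : ∀ q, z q i = q.2 := fun q => by
    simp only [z]
    rw [div_mul_cancel₀ _ (hb i).ne']
    ring
  have hzle : ∀ q : ℝ × ℝ, 0 ≤ q.1 → 0 ≤ q.2 → ∀ k, q.2 ≤ z q k := fun q h1 h2 k => by
    rw [← hzi q]
    simp only [z]
    have : (q.1 + q.2) / b i * b i ≤ (q.1 + q.2) / b i * b k :=
      mul_le_mul_of_nonneg_left (hi k) (div_nonneg (by linarith) (hb i).le)
    linarith
  have hzpos : ∀ q : ℝ × ℝ, 0 ≤ q.1 → 0 < q.2 → ∀ k, 0 < z q k := fun q h1 h2 k =>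
    lt_of_lt_of_le h2 (hzle q h1 h2.le k)
  have hwl : ∀ q : ℝ × ℝ, 0 ≤ q.1 → 0 < q.2 →
      IsWaterLevel b ((q.1 + q.2) / b i) q.1 (δ q) := fun q h1 h2 =>
    isWaterLevel_of_pos (hzpos q h1 h2)
  set lo := Real.exp (-T) with hlo
  have hlo0 : 0 < lo := Real.exp_pos _
  have hlo1 : lo ≤ 1 := Real.exp_le_one_iff.2 (by linarith)
  set B := P / (b i * T) with hBdef
  have hB : 0 < B := div_pos hP (mul_pos (hb i) hT)
  have hzc : ∀ k, Continuous fun q : ℝ × ℝ => min 1 (z q k) := fun k => by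
    simp only [z]
    fun_prop
  have hmin0 : ∀ q : ℝ × ℝ, 0 ≤ q.1 → 0 < q.2 → ∀ k, 0 < min 1 (z q k) := fun q h1 h2 k =>
    lt_min one_pos (hzpos q h1 h2 k)
  have hmem : ∀ q ∈ Set.Icc 0 B ×ˢ Set.Icc lo 1, 0 ≤ q.1 ∧ 0 < q.2 := fun q hq =>
    ⟨hq.1.1, hlo0.trans_le hq.2.1⟩
  have hδc : ∀ k, ContinuousOn (fun q => δ q k) (Set.Icc 0 B ×ˢ Set.Icc lo 1) := fun k =>
    ((hzc k).continuousOn.inv₀ fun q hq =>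
      (hmin0 q (hmem q hq).1 (hmem q hq).2 k).ne').sub continuousOn_const
  have hδ1 : ∀ q k, 1 + δ q k = (min 1 (z q k))⁻¹ := fun q k => by simp [δ]
  have hΦc : ContinuousOn (fun q => ∑ k, Real.log (1 + δ q k))
      (Set.Icc 0 B ×ˢ Set.Icc lo 1) := by
    refine continuousOn_finsetSum _ fun k _ => ContinuousOn.log
      (continuousOn_const.add (hδc k)) fun q hq => ?_
    rw [hδ1]
    exact (inv_pos.2 (hmin0 q (hmem q hq).1 (hmem q hq).2 k)).ne'
  have hgc : ContinuousOn (fun q => (∑ k, b k * δ q k) *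
      (∑ k, (1 - min 1 (z q k)) + q.1 * ∑ k, δ q k) - P * ∑ k, (1 - min 1 (z q k)))
      (Set.Icc 0 B ×ˢ Set.Icc lo 1) := by
    have c1 : ContinuousOn (fun q => ∑ k, b k * δ q k) (Set.Icc 0 B ×ˢ Set.Icc lo 1) :=
      continuousOn_finsetSum _ fun k _ => continuousOn_const.mul (hδc k)
    have c2 : ContinuousOn (fun q => ∑ k, δ q k) (Set.Icc 0 B ×ˢ Set.Icc lo 1) :=
      continuousOn_finsetSum _ fun k _ => hδc k
    have c3 : ContinuousOn (fun q => ∑ k, (1 - min 1 (z q k))) (Set.Icc 0 B ×ˢ Set.Icc lo 1) :=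
      continuousOn_finsetSum _ fun k _ => continuousOn_const.sub (hzc k).continuousOn
    exact (c1.mul (c3.add (continuous_fst.continuousOn.mul c2))).sub (continuousOn_const.mul c3)
  -- `∑ d / (1 + d)`, in the form used for continuity
  have hF : ∀ q : ℝ × ℝ, 0 ≤ q.1 → 0 < q.2 →
      ∑ k, (1 - min 1 (z q k)) = ∑ k, δ q k / (1 + δ q k) := fun q h1 h2 =>
    Finset.sum_congr rfl fun k _ => by
      have := (hmin0 q h1 h2 k).ne'
      rw [hδ1]
      simp only [δ]
      field_simp
  have hsum_pos : ∀ q : ℝ × ℝ, 0 ≤ q.1 → 0 < q.2 → ∑ k, Real.log (1 + δ q k) = T →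
      0 < ∑ k, δ q k := fun q h1 h2 hq => by
    by_contra hc
    have := sum_log_nonpos_of_sum_nonpos (hwl q h1 h2).nonneg (not_lt.1 hc)
    linarith
  have hsol := exists_eq_on_level hB.le _ _ hΦc hgc (T := T) ?_ ?_ ?_ ?_
  · obtain ⟨β, hβ, c, hc, hΦ, hg⟩ := hsol
    have h2 : 0 < c := hlo0.trans_le hc.1
    have hw := hwl (β, c) hβ.1 h2
    have hD := hsum_pos (β, c) hβ.1 h2 hΦ
    simp only [hF (β, c) hβ.1 h2, hw.sum_div] at hg
    have hα : 0 < (β + c) / b i := div_pos (by linarith [hβ.1]) (hb i)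
    have hF0 : 0 < ∑ k, δ (β, c) k / (1 + δ (β, c) k) := by
      obtain ⟨k, _, hk⟩ := Finset.exists_lt_of_sum_lt (s := Finset.univ)
        (f := fun _ => (0 : ℝ)) (g := δ (β, c)) (by simpa using hD)
      exact Finset.sum_pos' (fun j _ => div_nonneg (hw.nonneg j) (by linarith [hw.nonneg j]))
        ⟨k, Finset.mem_univ k, div_pos hk (by linarith)⟩
    rw [hw.sum_div] at hF0
    refine ⟨(β + c) / b i, β, δ (β, c), hα, hβ.1, hw, hΦ, ?_, ?_⟩
    · have h3 : 0 ≤ β * ∑ k, δ (β, c) k := mul_nonneg hβ.1 hD.le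
      simp only at hF0 hg
      have hs0 : 0 ≤ ∑ k, b k * δ (β, c) k :=
        Finset.sum_nonneg fun k _ => mul_nonneg (hb k).le (hw.nonneg k)
      by_contra hcon
      nlinarith
    · linarith
  · -- the level set meets every vertical line
    intro β hβ
    have hcont : ContinuousOn (fun c => ∑ k, Real.log (1 + δ (β, c) k)) (Set.Icc lo 1) :=
      hΦc.comp (f := fun c => (β, c)) (by fun_prop) fun c hc => ⟨hβ, hc⟩
    have hsub := intermediate_value_Icc' hlo1 hcont
    refine hsub ⟨?_, ?_⟩
    · have : ∀ k, min 1 (z (β, 1) k) = 1 := fun k =>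
        min_eq_left (hzle (β, 1) hβ.1 zero_le_one k)
      simp only [hδ1, this]
      simp [hT.le]
    · have h1 : Real.log (1 + δ (β, lo) i) = T := by
        rw [hδ1, hzi]
        simp only
        rw [min_eq_right hlo1, Real.log_inv, hlo, Real.log_exp, neg_neg]
      rw [← h1]
      exact Finset.single_le_sum (f := fun k => Real.log (1 + δ (β, lo) k))
        (fun k _ => Real.log_nonneg (by linarith [(hwl (β, lo) hβ.1 hlo0).nonneg k]))
        (Finset.mem_univ i)
  · -- the rate is strictly decreasing in `c ≤ 1`, as channel `i` is
    intro β hβ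
    have hanti : ∀ c ∈ Set.Icc lo 1, ∀ c' ∈ Set.Icc lo 1, c < c' →
        ∑ k, Real.log (1 + δ (β, c') k) < ∑ k, Real.log (1 + δ (β, c) k) := by
      intro c hc c' hc' hlt
      have hc0 : 0 < c := hlo0.trans_le hc.1
      have hc0' : 0 < c' := hlo0.trans_le hc'.1
      simp only [hδ1, Real.log_inv]
      refine Finset.sum_lt_sum (fun k _ => ?_) ⟨i, Finset.mem_univ i, ?_⟩
      · refine neg_le_neg (Real.log_le_log (hmin0 (β, c) hβ.1 hc0 k) (min_le_min_left _ ?_))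
        simp only [z]
        have h5 : (β + c) / b i ≤ (β + c') / b i :=
          div_le_div_of_nonneg_right (by linarith) (hb i).le
        have := mul_le_mul_of_nonneg_right h5 (hb k).le
        linarith
      · simp only [hzi]
        rw [min_eq_right hc.2, min_eq_right hc'.2]
        exact neg_lt_neg (Real.log_lt_log hc0 hlt)
    intro c hc c' hc' h1 h2
    rcases lt_trichotomy c c' with h | h | h
    · have := hanti c hc c' hc' h
      linarith
    · exact h
    · have := hanti c' hc' c hc h
      linarith
  · -- for `β = 0` this is the waterfilling of least power
    intro c hc hcT
    have hc0 : 0 < c := hlo0.trans_le hc.1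
    have hw := hwl (0, c) le_rfl hc0
    have h1 := hw.sum_log_le he
    have hF0 : 0 ≤ ∑ k, (1 - min 1 (z (0, c) k)) :=
      Finset.sum_nonneg fun k _ => sub_nonneg.2 (min_le_left _ _)
    have hα : 0 < (0 + c) / b i := div_pos (by linarith) (hb i)
    simp only at h1 hcT
    have h2 : 0 ≤ (0 + c) / b i * (∑ k, b k * e k - ∑ k, b k * δ (0, c) k) := by linarith
    have h3 := nonneg_of_mul_nonneg_right h2 hα
    simp only [zero_mul, add_zero]
    nlinarith
  · intro c hc hcT
    have hc0 : 0 < c := hlo0.trans_le hc.1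
    have hw := hwl (B, c) hB.le hc0
    have hF := hF (B, c) hB.le hc0
    have hF0 : 0 ≤ ∑ k, (1 - min 1 (z (B, c) k)) :=
      Finset.sum_nonneg fun k _ => sub_nonneg.2 (min_le_left _ _)
    have hDF : ∑ k, (1 - min 1 (z (B, c) k)) ≤ ∑ k, δ (B, c) k := by
      rw [hF]
      exact Finset.sum_le_sum fun k _ =>
        div_le_self (hw.nonneg k) (by linarith [hw.nonneg k])
    have hDT : T ≤ ∑ k, δ (B, c) k := by
      rw [← hcT]
      refine Finset.sum_le_sum fun k _ => ?_
      have := Real.log_le_sub_one_of_pos (x := 1 + δ (B, c) k) (by linarith [hw.nonneg k])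
      linarith
    have hs : b i * ∑ k, δ (B, c) k ≤ ∑ k, b k * δ (B, c) k := by
      rw [Finset.mul_sum]
      exact Finset.sum_le_sum fun k _ => mul_le_mul_of_nonneg_right (hi k) (hw.nonneg k)
    have hs' : b i * T ≤ ∑ k, b k * δ (B, c) k :=
      (mul_le_mul_of_nonneg_left hDT (hb i).le).trans hs
    have hbT : 0 < b i * T := mul_pos (hb i) hT
    have hBs : P ≤ (∑ k, b k * δ (B, c) k) * B := by
      have : b i * T * B = P := by rw [hBdef, mul_comm, div_mul_cancel₀ _ hbT.ne']
      rw [← this]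
      exact mul_le_mul_of_nonneg_right hs' hB.le
    have h6 : P * ∑ k, (1 - min 1 (z (B, c) k)) ≤
        (∑ k, b k * δ (B, c) k) * B * ∑ k, δ (B, c) k :=
      mul_le_mul hBs hDF hF0 (hP.le.trans hBs)
    have h7 : 0 ≤ (∑ k, b k * δ (B, c) k) * ∑ k, (1 - min 1 (z (B, c) k)) :=
      mul_nonneg (hbT.le.trans hs') hF0
    linarith

end Scalar

/-! ### Hadamard's inequality -/

section Hadamard

variable {n : Type*} [Fintype n]

lemma posSemidef_mul_eq_zero {m : Type*} [Fintype m] {S : Matrix n n ℂ} (hS : S.PosSemidef)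
    {W : Matrix n m ℂ} (h : (Wᴴ * S * W).trace = 0) : S * W = 0 := by
  have h0 := (hS.conjTranspose_mul_mul_same W).trace_eq_zero_iff.1 h
  ext i j
  have h1 : star (fun l => W l j) ⬝ᵥ (S *ᵥ fun l => W l j) = 0 := by
    have h2 := congrFun (congrFun h0 j) j
    rw [Matrix.mul_assoc] at h2
    exact h2
  exact congrFun ((hS.dotProduct_mulVec_zero_iff _).1 h1) i

variable [DecidableEq n]

lemma det_re_le_one_of_trace_eq {A : Matrix n n ℂ} (hA : A.PosDef)
    (htr : A.trace = Fintype.card n) :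
    A.det.re ≤ 1 ∧ (1 ≤ A.det.re → A = 1) := by
  have hpos := hA.eigenvalues_pos
  set ev := hA.1.eigenvalues with hev
  have hdet : A.det.re = ∏ i, ev i := by
    rw [hA.1.det_eq_prod_eigenvalues, ← Complex.ofReal_re (∏ i, ev i)]
    push_cast
    rfl
  have hsum : ∑ i, (ev i - 1) = 0 := by
    have h1 := congrArg Complex.re hA.1.trace_eq_sum_eigenvalues
    rw [htr] at h1
    simp only [Complex.natCast_re, Complex.re_sum] at h1
    rw [Finset.sum_sub_distrib, sub_eq_zero]
    simpa using h1.symm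
  have hlog : Real.log A.det.re = ∑ i, Real.log (ev i) := by
    rw [hdet, Real.log_prod fun i _ => (hpos i).ne']
  have hd0 : 0 < A.det.re := by
    rw [hdet]
    exact Finset.prod_pos fun i _ => hpos i
  refine ⟨?_, fun h => ?_⟩
  · rw [← Real.log_nonpos_iff hd0.le, hlog, ← hsum]
    exact Finset.sum_le_sum fun i _ => Real.log_le_sub_one_of_pos (hpos i)
  · have hone : ∀ i, ev i = 1 := by
      by_contra! hne
      obtain ⟨i, hi⟩ := hne
      have h1 : ∑ i, Real.log (ev i) < ∑ i, (ev i - 1) :=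
        Finset.sum_lt_sum (fun i _ => Real.log_le_sub_one_of_pos (hpos i))
          ⟨i, Finset.mem_univ i, Real.log_lt_sub_one_of_pos (hpos i) hi⟩
      have h2 := Real.log_nonneg h
      linarith
    rw [hA.1.spectral_theorem]
    have : (RCLike.ofReal ∘ hA.1.eigenvalues : n → ℂ) = 1 := by
      funext i
      simp [← hev, hone i]
    rw [this, show Matrix.diagonal (1 : n → ℂ) = 1 from Matrix.diagonal_one, map_one]

/-- Hadamard's inequality, with its equality case, by scaling the diagonal to `1`. -/
lemma det_re_le_prod_diag {M : Matrix n n ℂ} (hM : M.PosDef) :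
    M.det.re ≤ ∏ k, (M k k).re ∧
      (∏ k, (M k k).re ≤ M.det.re → ∀ j k, j ≠ k → M j k = 0) := by
  have hre : ∀ k, 0 < (M k k).re := fun k => (Complex.pos_iff.1 hM.diag_pos).1
  have him : ∀ k, M k k = ((M k k).re : ℂ) := fun k =>
    Complex.ext rfl (by simpa using (Complex.pos_iff.1 (hM.diag_pos (i := k))).2.symm)
  set w : n → ℝ := fun k => (Real.sqrt (M k k).re)⁻¹ with hw
  have hw0 : ∀ k, 0 < w k := fun k => inv_pos.2 (Real.sqrt_pos.2 (hre k))
  have hw2 : ∀ k, w k * (M k k).re * w k = 1 := fun k => by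
    have h := Real.mul_self_sqrt (hre k).le
    have h' := (Real.sqrt_pos.2 (hre k)).ne'
    simp only [hw]
    field_simp
    linarith
  set D : Matrix n n ℂ := Matrix.diagonal fun k => (w k : ℂ) with hD
  have hDH : Dᴴ = D := by
    simp [hD, Matrix.diagonal_conjTranspose, Pi.star_def]
  have hDu : IsUnit D := by
    rw [Matrix.isUnit_iff_isUnit_det, hD, Matrix.det_diagonal, isUnit_iff_ne_zero]
    exact Finset.prod_ne_zero_iff.2 fun k _ => by simpa using (hw0 k).ne'
  have hA : (D * M * D).PosDef := by
    have := (Matrix.IsUnit.posDef_star_left_conjugate_iff (x := M) hDu).2 hM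
    rwa [Matrix.star_eq_conjTranspose, hDH] at this
  have hentry : ∀ j k, (D * M * D) j k = w j * M j k * w k := fun j k => by
    simp [hD, Matrix.diagonal_mul, Matrix.mul_diagonal]
  have hdiag : ∀ k, (D * M * D) k k = 1 := fun k => by
    rw [hentry, him k]
    exact_mod_cast hw2 k
  have htr : (D * M * D).trace = Fintype.card n := by
    simp [Matrix.trace, hdiag]
  have hdet : (D * M * D).det.re = (∏ k, w k) ^ 2 * M.det.re := by
    rw [Matrix.det_mul, Matrix.det_mul, hD, Matrix.det_diagonal, ← Complex.ofReal_prod]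
    rw [show ((∏ k, w k : ℝ) : ℂ) * M.det * ((∏ k, w k : ℝ) : ℂ)
      = (((∏ k, w k) ^ 2 : ℝ) : ℂ) * M.det by push_cast; ring]
    exact Complex.re_ofReal_mul _ _
  have hprod : (∏ k, w k) ^ 2 * ∏ k, (M k k).re = 1 := by
    rw [sq, mul_assoc, mul_comm, ← Finset.prod_mul_distrib, ← Finset.prod_mul_distrib]
    exact Finset.prod_eq_one fun k _ => hw2 k
  have hp0 : 0 < (∏ k, w k) ^ 2 := pow_pos (Finset.prod_pos fun k _ => hw0 k) 2
  obtain ⟨h1, h2⟩ := det_re_le_one_of_trace_eq hA htr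
  rw [hdet, ← hprod] at h1 h2
  refine ⟨le_of_mul_le_mul_left h1 hp0, fun h j k hjk => ?_⟩
  have h3 := h2 (mul_le_mul_of_nonneg_left h hp0.le)
  have h4 := hentry j k
  rw [h3, Matrix.one_apply_ne hjk] at h4
  have hj : (w j : ℂ) ≠ 0 := by exact_mod_cast (hw0 j).ne'
  have hk : (w k : ℂ) ≠ 0 := by exact_mod_cast (hw0 k).ne'
  rcases mul_eq_zero.1 h4.symm with h5 | h5
  · exact (mul_eq_zero.1 h5).resolve_left hj
  · exact absurd h5 hk

end Hadamard

/-! ### Reduction to the eigenchannels -/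

section Channels

variable {NR NT r : ℕ} {H : Matrix (Fin NR) (Fin NT) ℂ} {U : Matrix (Fin NR) (Fin r) ℂ}
  {lam : Fin r → ℝ} {V : Matrix (Fin NT) (Fin r) ℂ}

/-- `σ² / λ_k²`, the power that raises the `k`-th eigenchannel to signal-to-noise ratio `1`. -/
noncomputable def invGain (lam : Fin r → ℝ) (σ : ℝ) (k : Fin r) : ℝ :=
  σ ^ 2 / lam k ^ 2

/-- The power that the covariance `S` puts into the `k`-th eigenchannel. -/
noncomputable def channelPower (V : Matrix (Fin NT) (Fin r) ℂ)
    (S : Matrix (Fin NT) (Fin NT) ℂ) (k : Fin r) : ℝ :=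
  ((Vᴴ * S * V) k k).re

lemma channelPower_nonneg {S : Matrix (Fin NT) (Fin NT) ℂ} (hS : S.PosSemidef) (k : Fin r) :
    0 ≤ channelPower V S k :=
  (Complex.nonneg_iff.1 (hS.conjTranspose_mul_mul_same V).diag_nonneg).1

lemma recvCov_eq (h : IsReducedSVD H U lam V) (S : Matrix (Fin NT) (Fin NT) ℂ) :
    recvCov H S = U * (Matrix.diagonal (fun k => (lam k : ℂ)) * (Vᴴ * S * V) *
      Matrix.diagonal (fun k => (lam k : ℂ))) * Uᴴ := by
  have hL : (Matrix.diagonal (fun k => (lam k : ℂ)))ᴴ = Matrix.diagonal (fun k => (lam k : ℂ)) := by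
    simp [Matrix.diagonal_conjTranspose, Pi.star_def]
  rw [recvCov, h.eq]
  simp only [Matrix.conjTranspose_mul, Matrix.conjTranspose_conjTranspose, hL, Matrix.mul_assoc]

lemma trace_conj (h : IsReducedSVD H U lam V) (X : Matrix (Fin r) (Fin r) ℂ) :
    (U * X * Uᴴ).trace = X.trace := by
  rw [Matrix.trace_mul_cycle, h.U_orth, Matrix.one_mul]

lemma recvPower_eq (h : IsReducedSVD H U lam V) (S : Matrix (Fin NT) (Fin NT) ℂ) :
    recvPower H S = ∑ k, lam k ^ 2 * channelPower V S k := by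
  rw [recvPower, recvCov_eq h, trace_conj h, Matrix.trace, Complex.re_sum]
  refine Finset.sum_congr rfl fun k _ => ?_
  rw [Matrix.diag_apply, Matrix.mul_diagonal, Matrix.diagonal_mul, channelPower]
  rw [show (lam k : ℂ) * (Vᴴ * S * V) k k * (lam k : ℂ)
    = ((lam k ^ 2 : ℝ) : ℂ) * (Vᴴ * S * V) k k by push_cast; ring]
  exact Complex.re_ofReal_mul _ _

/-- The part `I + (1 - ρ) σ⁻² Λ Vᴴ S V Λ` of the information matrix seen by the eigenchannels. -/
noncomputable def channelMat (lam : Fin r → ℝ) (V : Matrix (Fin NT) (Fin r) ℂ) (σ : ℝ)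
    (S : Matrix (Fin NT) (Fin NT) ℂ) (ρ : ℝ) : Matrix (Fin r) (Fin r) ℂ :=
  1 + (((1 - ρ) / σ ^ 2 : ℝ) : ℂ) • (Matrix.diagonal (fun k => (lam k : ℂ)) * (Vᴴ * S * V) *
    Matrix.diagonal (fun k => (lam k : ℂ)))

lemma det_infoMat (h : IsReducedSVD H U lam V) (σ : ℝ) (S : Matrix (Fin NT) (Fin NT) ℂ) (ρ : ℝ) :
    (infoMat H σ S ρ).det = (channelMat lam V σ S ρ).det := by
  rw [infoMat, recvCov_eq h, ← Matrix.smul_mul, ← Matrix.mul_smul, Matrix.mul_assoc,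
    Matrix.det_one_add_mul_comm, Matrix.mul_assoc, h.U_orth, Matrix.mul_one, channelMat]

lemma channelMat_apply (σ : ℝ) (S : Matrix (Fin NT) (Fin NT) ℂ) (ρ : ℝ) (j k : Fin r) :
    channelMat lam V σ S ρ j k = (1 : Matrix (Fin r) (Fin r) ℂ) j k +
      (((1 - ρ) / σ ^ 2 * (lam j * lam k) : ℝ) : ℂ) * (Vᴴ * S * V) j k := by
  rw [channelMat, Matrix.add_apply, Matrix.smul_apply, Matrix.mul_diagonal, Matrix.diagonal_mul,
    smul_eq_mul]
  push_cast
  ring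

lemma channelMat_posDef {S : Matrix (Fin NT) (Fin NT) ℂ} (hS : S.PosSemidef) {σ ρ : ℝ}
    (hρ : ρ ≤ 1) : (channelMat lam V σ S ρ).PosDef := by
  refine Matrix.PosDef.one.add_posSemidef (Matrix.PosSemidef.smul ?_ ?_)
  · have := (hS.conjTranspose_mul_mul_same V).conjTranspose_mul_mul_same
      (Matrix.diagonal (fun k => (lam k : ℂ)))
    simpa [Matrix.diagonal_conjTranspose, Pi.star_def] using this
  · exact_mod_cast div_nonneg (by linarith : (0 : ℝ) ≤ 1 - ρ) (sq_nonneg σ)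

lemma channelMat_diag (σ : ℝ) (S : Matrix (Fin NT) (Fin NT) ℂ) (ρ : ℝ) (k : Fin r) :
    (channelMat lam V σ S ρ k k).re
      = 1 + (1 - ρ) * channelPower V S k / invGain lam σ k := by
  rw [channelMat_apply, Complex.add_re, Complex.re_ofReal_mul, Matrix.one_apply_eq,
    Complex.one_re, channelPower, invGain, div_div_eq_mul_div]
  ring

/-- Hadamard's inequality: the rate is at most that of the powers put into the eigenchannels,
used as independent channels, and equality forces these to be uncorrelated. -/
lemma rate_le (h : IsReducedSVD H U lam V) {σ ρ : ℝ} (hσ : 0 < σ) (hρ : ρ ≤ 1)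
    {S : Matrix (Fin NT) (Fin NT) ℂ} (hS : S.PosSemidef) :
    rate H σ S ρ * Real.log 2
        ≤ ∑ k, Real.log (1 + (1 - ρ) * channelPower V S k / invGain lam σ k) ∧
      (∑ k, Real.log (1 + (1 - ρ) * channelPower V S k / invGain lam σ k)
          ≤ rate H σ S ρ * Real.log 2 → ρ < 1 →
        Vᴴ * S * V = Matrix.diagonal fun k => (channelPower V S k : ℂ)) := by
  have hM := channelMat_posDef (lam := lam) (V := V) hS (σ := σ) hρ
  have hlog2 : Real.log 2 ≠ 0 := (Real.log_pos one_lt_two).ne'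
  have hpos : ∀ k, 0 < 1 + (1 - ρ) * channelPower V S k / invGain lam σ k := fun k => by
    rw [← channelMat_diag]
    exact (Complex.pos_iff.1 hM.diag_pos).1
  have hdet0 : 0 < (channelMat lam V σ S ρ).det.re := (Complex.pos_iff.1 hM.det_pos).1
  obtain ⟨h1, h2⟩ := det_re_le_prod_diag hM
  simp only [channelMat_diag] at h1 h2
  rw [rate, Real.logb, div_mul_cancel₀ _ hlog2, det_infoMat h,
    ← Real.log_prod fun k _ => (hpos k).ne']
  refine ⟨Real.log_le_log hdet0 h1, fun h3 hρ1 => ?_⟩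
  have h4 := h2 ((Real.log_le_log_iff (Finset.prod_pos fun k _ => hpos k) hdet0).1 h3)
  ext j k
  rcases eq_or_ne j k with rfl | hjk
  · rw [Matrix.diagonal_apply_eq]
    exact Complex.ext rfl (by
      simpa using (Complex.nonneg_iff.1
        ((hS.conjTranspose_mul_mul_same V).diag_nonneg (i := j))).2.symm)
  · rw [Matrix.diagonal_apply_ne _ hjk]
    have h5 := h4 j k hjk
    rw [channelMat_apply, Matrix.one_apply_ne hjk, zero_add] at h5
    refine (mul_eq_zero.1 h5).resolve_left ?_
    have := h.pos j
    have := h.pos k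
    have : 0 < 1 - ρ := by linarith
    exact_mod_cast (by positivity : (0 : ℝ) < (1 - ρ) / σ ^ 2 * (lam j * lam k)).ne'

/-- The eigenchannels carry at most the transmit power, and all of it only if `S` lives on the
range of `V`. -/
lemma sum_channelPower_le (h : IsReducedSVD H U lam V) {S : Matrix (Fin NT) (Fin NT) ℂ}
    (hS : S.PosSemidef) : ∑ k, channelPower V S k ≤ S.trace.re ∧
      (S.trace.re ≤ ∑ k, channelPower V S k → S = V * (Vᴴ * S * V) * Vᴴ) := by
  set W : Matrix (Fin NT) (Fin NT) ℂ := 1 - V * Vᴴ with hW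
  have hWH : Wᴴ = W := by simp [hW, Matrix.conjTranspose_sub, Matrix.conjTranspose_mul]
  have hWW : W * W = W := by
    have : V * Vᴴ * (V * Vᴴ) = V * Vᴴ := by
      rw [Matrix.mul_assoc, ← Matrix.mul_assoc Vᴴ, h.V_orth, Matrix.one_mul]
    rw [hW, mul_sub, sub_mul, sub_mul, this]
    simp
  have htr : (Wᴴ * S * W).trace = S.trace - (Vᴴ * S * V).trace := by
    rw [Matrix.trace_mul_cycle, hWH, hWW, Matrix.trace_mul_comm, hW, mul_sub, Matrix.trace_sub,
      mul_one, ← Matrix.mul_assoc, Matrix.trace_mul_comm (S * V), Matrix.mul_assoc]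
  have hsum : (Vᴴ * S * V).trace.re = ∑ k, channelPower V S k := by
    simp [Matrix.trace, channelPower]
  have hpsd := (hS.conjTranspose_mul_mul_same W).trace_nonneg
  have hre := (Complex.nonneg_iff.1 hpsd).1
  have him := (Complex.nonneg_iff.1 hpsd).2
  have h0 : (Wᴴ * S * W).trace.re = S.trace.re - ∑ k, channelPower V S k := by
    rw [htr, Complex.sub_re, hsum]
  refine ⟨by linarith, fun hle => ?_⟩
  have hSW : S * W = 0 := posSemidef_mul_eq_zero hS
    (Complex.ext (by simp only [Complex.zero_re]; linarith) (by simpa using him.symm))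
  have e1 : S = S * (V * Vᴴ) := by
    rw [hW, mul_sub, mul_one, sub_eq_zero] at hSW
    exact hSW
  have e2 : S = V * Vᴴ * S := by
    have := congrArg Matrix.conjTranspose e1
    simpa [Matrix.conjTranspose_mul, hS.1.eq, ← Matrix.mul_assoc] using this
  calc S = V * Vᴴ * S := e2
    _ = V * Vᴴ * (S * (V * Vᴴ)) := by rw [← e1]
    _ = V * (Vᴴ * S * V) * Vᴴ := by simp only [Matrix.mul_assoc]

/-! ### Covariances diagonal in the eigenchannels -/

lemma conj_covOfPowers (hV : Vᴴ * V = 1) (p : Fin r → ℝ) :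
    Vᴴ * covOfPowers V p * V = Matrix.diagonal fun k => (p k : ℂ) := by
  rw [covOfPowers]
  calc Vᴴ * (V * Matrix.diagonal (fun k => (p k : ℂ)) * Vᴴ) * V
      = (Vᴴ * V) * Matrix.diagonal (fun k => (p k : ℂ)) * (Vᴴ * V) := by
        simp only [Matrix.mul_assoc]
    _ = _ := by rw [hV, Matrix.one_mul, Matrix.mul_one]

lemma channelPower_covOfPowers (h : IsReducedSVD H U lam V) (p : Fin r → ℝ) :
    channelPower V (covOfPowers V p) = p := by
  funext k
  simp [channelPower, conj_covOfPowers h.V_orth]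

lemma posSemidef_conj_diagonal {p : Fin r → ℝ} (hp : ∀ k, 0 ≤ p k) :
    (V * Matrix.diagonal (fun k => (p k : ℂ)) * Vᴴ).PosSemidef :=
  (Matrix.PosSemidef.diagonal (fun k => by simpa using hp k)).mul_mul_conjTranspose_same V

lemma covOfPowers_posSemidef {p : Fin r → ℝ} (hp : ∀ k, 0 ≤ p k) :
    (covOfPowers V p).PosSemidef :=
  posSemidef_conj_diagonal hp

lemma trace_covOfPowers (h : IsReducedSVD H U lam V) (p : Fin r → ℝ) :
    (covOfPowers V p).trace.re = ∑ k, p k := by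
  rw [covOfPowers, Matrix.trace_mul_cycle, h.V_orth, Matrix.one_mul]
  simp

lemma recvPower_covOfPowers (h : IsReducedSVD H U lam V) (p : Fin r → ℝ) :
    recvPower H (covOfPowers V p) = ∑ k, lam k ^ 2 * p k := by
  rw [recvPower_eq h, channelPower_covOfPowers h]

lemma rate_covOfPowers (h : IsReducedSVD H U lam V) {p : Fin r → ℝ} (hp : ∀ k, 0 ≤ p k)
    {σ ρ : ℝ} (hρ : ρ ≤ 1) :
    rate H σ (covOfPowers V p) ρ * Real.log 2
      = ∑ k, Real.log (1 + (1 - ρ) * p k / invGain lam σ k) := by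
  have hlog2 : Real.log 2 ≠ 0 := (Real.log_pos one_lt_two).ne'
  have hM : channelMat lam V σ (covOfPowers V p) ρ = Matrix.diagonal fun k =>
      ((1 + (1 - ρ) * p k / invGain lam σ k : ℝ) : ℂ) := by
    ext j k
    rw [channelMat_apply, conj_covOfPowers h.V_orth]
    rcases eq_or_ne j k with rfl | hjk
    · rw [Matrix.one_apply_eq, Matrix.diagonal_apply_eq, Matrix.diagonal_apply_eq,
        invGain, div_div_eq_mul_div]
      push_cast
      ring
    · simp [Matrix.one_apply_ne hjk, Matrix.diagonal_apply_ne _ hjk]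
  rw [rate, Real.logb, div_mul_cancel₀ _ hlog2, det_infoMat h, hM, Matrix.det_diagonal,
    ← Complex.ofReal_prod, Complex.ofReal_re, Real.log_prod]
  intro k _
  have : 0 ≤ (1 - ρ) * p k / invGain lam σ k :=
    div_nonneg (mul_nonneg (by linarith) (hp k)) (div_nonneg (sq_nonneg σ) (sq_nonneg _))
  positivity

end Channels

/-! ### The KKT system in the eigenchannels -/

section KKT

variable {NR NT r : ℕ} {H : Matrix (Fin NR) (Fin NT) ℂ} {U : Matrix (Fin NR) (Fin r) ℂ}
  {lam : Fin r → ℝ} {V : Matrix (Fin NT) (Fin r) ℂ}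

lemma covOfPowers_add (p q : Fin r → ℝ) :
    covOfPowers V p + covOfPowers V q = covOfPowers V (fun k => p k + q k) := by
  rw [covOfPowers, covOfPowers, covOfPowers, ← Matrix.add_mul, ← Matrix.mul_add,
    Matrix.diagonal_add]
  simp

lemma covOfPowers_smul (c : ℝ) (p : Fin r → ℝ) :
    (c : ℂ) • covOfPowers V p = covOfPowers V (fun k => c * p k) := by
  rw [covOfPowers, covOfPowers, ← Matrix.smul_mul, ← Matrix.mul_smul, ← Matrix.diagonal_smul]
  congr 3
  funext k
  simp

lemma covOfPowers_mul (hV : Vᴴ * V = 1) (p q : Fin r → ℝ) :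
    covOfPowers V p * covOfPowers V q = covOfPowers V (fun k => p k * q k) := by
  simp only [covOfPowers]
  calc _ = V * Matrix.diagonal (fun k => (p k : ℂ)) * (Vᴴ * V) *
        Matrix.diagonal (fun k => (q k : ℂ)) * Vᴴ := by simp only [Matrix.mul_assoc]
    _ = _ := by
      rw [hV, Matrix.mul_one, Matrix.mul_assoc V, Matrix.diagonal_mul_diagonal]
      simp

lemma recvCov_covOfPowers (h : IsReducedSVD H U lam V) (p : Fin r → ℝ) :
    recvCov H (covOfPowers V p) = covOfPowers U (fun k => lam k ^ 2 * p k) := by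
  rw [recvCov_eq h, conj_covOfPowers h.V_orth, covOfPowers, Matrix.diagonal_mul_diagonal,
    Matrix.diagonal_mul_diagonal]
  congr 3
  funext k
  push_cast
  ring

lemma infoMat_covOfPowers (h : IsReducedSVD H U lam V) (σ ρ : ℝ) (p : Fin r → ℝ) :
    infoMat H σ (covOfPowers V p) ρ
      = 1 + covOfPowers U (fun k => (1 - ρ) * p k / invGain lam σ k) := by
  rw [infoMat, recvCov_covOfPowers h, covOfPowers_smul]
  congr 2
  funext k
  rw [invGain, div_div_eq_mul_div]
  ring

lemma inv_one_add_covOfPowers (hU : Uᴴ * U = 1) {e : Fin r → ℝ} (he : ∀ k, 0 ≤ e k) :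
    (1 + covOfPowers U e)⁻¹ = 1 + covOfPowers U (fun k => -(e k / (1 + e k))) := by
  refine Matrix.inv_eq_right_inv ?_
  rw [add_mul, one_mul, mul_add, mul_one, covOfPowers_mul hU, add_assoc, covOfPowers_add,
    covOfPowers_add]
  have : (fun k => -(e k / (1 + e k)) + (e k + e k * -(e k / (1 + e k)))) = fun _ => 0 := by
    funext k
    have : 1 + e k ≠ 0 := by linarith [he k]
    field_simp
    ring
  rw [this]
  simp [covOfPowers]

lemma conjTranspose_mul_one_add_mul (h : IsReducedSVD H U lam V) (f : Fin r → ℝ) :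
    Hᴴ * (1 + covOfPowers U f) * H = covOfPowers V (fun k => lam k ^ 2 * (1 + f k)) := by
  have hL : (Matrix.diagonal (fun k => (lam k : ℂ)))ᴴ = Matrix.diagonal (fun k => (lam k : ℂ)) := by
    simp [Matrix.diagonal_conjTranspose, Pi.star_def]
  have h1 : Uᴴ * (1 + covOfPowers U f) * U = Matrix.diagonal fun k => ((1 + f k : ℝ) : ℂ) := by
    rw [Matrix.mul_add, Matrix.add_mul, Matrix.mul_one, h.U_orth, conj_covOfPowers h.U_orth,
      ← Matrix.diagonal_one, Matrix.diagonal_add]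
    simp
  calc Hᴴ * (1 + covOfPowers U f) * H
      = V * (Matrix.diagonal (fun k => (lam k : ℂ)) * (Uᴴ * (1 + covOfPowers U f) * U) *
          Matrix.diagonal (fun k => (lam k : ℂ))) * Vᴴ := by
        rw [h.eq]
        simp only [Matrix.conjTranspose_mul, Matrix.conjTranspose_conjTranspose, hL,
          Matrix.mul_assoc]
    _ = _ := by
        rw [h1, Matrix.diagonal_mul_diagonal, Matrix.diagonal_mul_diagonal, covOfPowers]
        congr 3
        funext k
        push_cast
        ring

variable {p : Fin r → ℝ} {σ ρ : ℝ}

lemma snr_nonneg (hp : ∀ k, 0 ≤ p k) (hρ : ρ ≤ 1) (k : Fin r) :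
    0 ≤ (1 - ρ) * p k / invGain lam σ k :=
  div_nonneg (mul_nonneg (by linarith) (hp k)) (div_nonneg (sq_nonneg _) (sq_nonneg _))

lemma rateSlope_covOfPowers (h : IsReducedSVD H U lam V) (hp : ∀ k, 0 ≤ p k) (hρ : ρ ≤ 1) :
    rateSlope H σ (covOfPowers V p) ρ = 1 / (σ ^ 2 * Real.log 2) *
      ∑ k, lam k ^ 2 * p k / (1 + (1 - ρ) * p k / invGain lam σ k) := by
  have he := snr_nonneg (lam := lam) (σ := σ) hp hρ
  rw [rateSlope, infoMat_covOfPowers h, inv_one_add_covOfPowers h.U_orth he,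
    recvCov_covOfPowers h, mul_add, mul_one, covOfPowers_mul h.U_orth, covOfPowers_add,
    covOfPowers_smul, covOfPowers, Matrix.trace_mul_cycle, h.U_orth, Matrix.one_mul,
    Matrix.trace_diagonal, ← Complex.ofReal_sum, Complex.ofReal_re, ← Finset.mul_sum]
  congr 1
  refine Finset.sum_congr rfl fun k _ => ?_
  have : 1 + (1 - ρ) * p k / invGain lam σ k ≠ 0 := by linarith [he k]
  set e := (1 - ρ) * p k / invGain lam σ k
  field_simp
  ring

/-- The eigenvalue of `∂L/∂S + ν I` on the `k`-th eigenchannel. -/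
noncomputable def channelGrad (lam : Fin r → ℝ) (σ : ℝ) (p : Fin r → ℝ) (ρ μ : ℝ)
    (k : Fin r) : ℝ :=
  μ * (1 - ρ) / (σ ^ 2 * Real.log 2) *
    (lam k ^ 2 / (1 + (1 - ρ) * p k / invGain lam σ k)) + ρ * lam k ^ 2

lemma gradS_covOfPowers (h : IsReducedSVD H U lam V) (hp : ∀ k, 0 ≤ p k) (hρ : ρ ≤ 1)
    (μ ν : ℝ) :
    gradS H σ (covOfPowers V p) ρ μ ν
      = covOfPowers V (channelGrad lam σ p ρ μ) - (ν : ℂ) • 1 := by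
  have he := snr_nonneg (lam := lam) (σ := σ) hp hρ
  have hHH : Hᴴ * H = covOfPowers V (fun k => lam k ^ 2) := by
    have := conjTranspose_mul_one_add_mul h (fun _ => 0)
    simpa [covOfPowers] using this
  rw [gradS, infoMat_covOfPowers h, inv_one_add_covOfPowers h.U_orth he,
    conjTranspose_mul_one_add_mul h, hHH, covOfPowers_smul, covOfPowers_smul, covOfPowers_add]
  congr 2
  funext k
  rw [channelGrad]
  have : 1 + (1 - ρ) * p k / invGain lam σ k ≠ 0 := by linarith [he k]
  congr 2
  set e := (1 - ρ) * p k / invGain lam σ k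
  field_simp
  ring

lemma gradS_mul_covOfPowers (h : IsReducedSVD H U lam V) (hp : ∀ k, 0 ≤ p k) (hρ : ρ ≤ 1)
    (μ ν : ℝ) :
    gradS H σ (covOfPowers V p) ρ μ ν * covOfPowers V p
      = covOfPowers V (fun k => (channelGrad lam σ p ρ μ k - ν) * p k) := by
  rw [gradS_covOfPowers h hp hρ, sub_mul, covOfPowers_mul h.V_orth, Matrix.smul_mul,
    Matrix.one_mul, sub_eq_iff_eq_add, covOfPowers_smul, covOfPowers_add]
  congr 1
  funext k
  ring

lemma neg_gradS_posSemidef (h : IsReducedSVD H U lam V) (hp : ∀ k, 0 ≤ p k) (hρ : ρ ≤ 1)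
    {μ ν : ℝ} (hν : 0 ≤ ν) (hle : ∀ k, channelGrad lam σ p ρ μ k ≤ ν) :
    (-gradS H σ (covOfPowers V p) ρ μ ν).PosSemidef := by
  -- `-∂L/∂S` is `ν` on the complement of the range of `V`
  have hdec : -gradS H σ (covOfPowers V p) ρ μ ν
      = (ν : ℂ) • (1 - V * Vᴴ)ᴴ * (1 - V * Vᴴ)
        + covOfPowers V (fun k => ν - channelGrad lam σ p ρ μ k) := by
    have hVV : V * Vᴴ * (V * Vᴴ) = V * Vᴴ := by
      rw [Matrix.mul_assoc, ← Matrix.mul_assoc Vᴴ, h.V_orth, Matrix.one_mul]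
    have hproj : (1 - V * Vᴴ)ᴴ * (1 - V * Vᴴ) = 1 - V * Vᴴ := by
      have : (1 - V * Vᴴ)ᴴ = 1 - V * Vᴴ := by
        simp [Matrix.conjTranspose_sub, Matrix.conjTranspose_mul]
      rw [this, mul_sub, sub_mul, sub_mul, hVV]
      simp
    have h1 : V * Vᴴ = covOfPowers V (fun _ => 1) := by simp [covOfPowers]
    rw [gradS_covOfPowers h hp hρ, Matrix.smul_mul, hproj, smul_sub, h1, covOfPowers_smul,
      neg_sub, sub_add, sub_right_inj, eq_sub_iff_add_eq, covOfPowers_add]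
    congr 1
    funext k
    ring
  rw [hdec, Matrix.smul_mul]
  refine Matrix.PosSemidef.add (Matrix.PosSemidef.smul
    (Matrix.posSemidef_conjTranspose_mul_self _) (by exact_mod_cast hν))
    (covOfPowers_posSemidef fun k => sub_nonneg.2 (hle k))

/-- On covariances that are diagonal in the eigenchannels the KKT conditions are scalar. -/
lemma isKKTPoint_covOfPowers (h : IsReducedSVD H U lam V) {P R μ ν : ℝ} (hp : ∀ k, 0 ≤ p k)
    (hf : Feasible H P σ R (covOfPowers V p) ρ) (hμ : 0 ≤ μ) (hν : 0 ≤ ν)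
    (hle : ∀ k, channelGrad lam σ p ρ μ k ≤ ν)
    (hslack : ∀ k, p k ≠ 0 → channelGrad lam σ p ρ μ k = ν)
    (hstat : μ * rateSlope H σ (covOfPowers V p) ρ = recvPower H (covOfPowers V p))
    (hrate : rate H σ (covOfPowers V p) ρ = R) (hpow : ∑ k, p k = P) :
    IsKKTPoint H P σ R (covOfPowers V p) ρ μ ν where
  feasible := hf
  mu_nonneg := hμ
  nu_nonneg := hν
  stat_S := neg_gradS_posSemidef h hp hf.ratio_mem.2 hν hle
  slack_S := by
    rw [gradS_mul_covOfPowers h hp hf.ratio_mem.2]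
    have : (fun k => (channelGrad lam σ p ρ μ k - ν) * p k) = fun _ => 0 := by
      funext k
      by_cases hk : p k = 0
      · simp [hk]
      · simp [hslack k hk]
    rw [this]
    simp [covOfPowers]
  stat_ρ := by linarith
  slack_rate := by rw [hrate]; ring
  slack_power := by rw [trace_covOfPowers h, hpow]; ring

lemma IsKKTPoint.channelGrad_eq (h : IsReducedSVD H U lam V) {P R μ ν : ℝ} (hp : ∀ k, 0 ≤ p k)
    (hk : IsKKTPoint H P σ R (covOfPowers V p) ρ μ ν) {k : Fin r} (hpk : p k ≠ 0) :
    channelGrad lam σ p ρ μ k = ν := by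
  have h1 := hk.slack_S
  rw [gradS_mul_covOfPowers h hp hk.feasible.ratio_mem.2] at h1
  have h2 := congrFun (channelPower_covOfPowers h
    (fun k => (channelGrad lam σ p ρ μ k - ν) * p k)) k
  rw [h1] at h2
  have h3 : (channelGrad lam σ p ρ μ k - ν) * p k = 0 := by
    rw [← h2]
    simp [channelPower]
  linarith [(mul_eq_zero.1 h3).resolve_right hpk]

/-! ### Stationary points are optimal -/

lemma invGain_pos (h : IsReducedSVD H U lam V) (hσ : 0 < σ) (k : Fin r) :
    0 < invGain lam σ k :=
  div_pos (pow_pos hσ 2) (pow_pos (h.pos k) 2)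

lemma sq_mul_invGain (h : IsReducedSVD H U lam V) (k : Fin r) :
    lam k ^ 2 * invGain lam σ k = σ ^ 2 := by
  rw [invGain, mul_div_cancel₀ _ (pow_pos (h.pos k) 2).ne']

/-- The first-order conditions of OP1 in terms of the splitting `x = 1 - ρ`, the multipliers
`μ`, `ν` and the signal-to-noise ratios `d k = x λ_k² p_k / σ²` of the eigenchannels. -/
structure IsStationary (lam : Fin r → ℝ) (P σ R x μ ν : ℝ) (d : Fin r → ℝ) : Prop where
  x_pos : 0 < x
  x_le : x ≤ 1
  mu_pos : 0 < μ
  nu_pos : 0 < ν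
  level : IsWaterLevel (invGain lam σ) (Real.log 2 * ν / (x * μ))
    (Real.log 2 * σ ^ 2 * (1 - x) / (x * μ)) d
  rate : ∑ k, Real.log (1 + d k) = R * Real.log 2
  power : ∑ k, invGain lam σ k * d k = x * P
  balance : σ ^ 2 * ∑ k, d k = ν * (x * P)

lemma sum_sq_mul_eq (h : IsReducedSVD H U lam V) (hσ : 0 < σ) {x : ℝ} (hx : x ≠ 0)
    (q : Fin r → ℝ) :
    ∑ k, lam k ^ 2 * q k = σ ^ 2 / x * ∑ k, x * q k / invGain lam σ k := by
  rw [Finset.mul_sum]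
  refine Finset.sum_congr rfl fun k _ => ?_
  have h1 := (invGain_pos h hσ k).ne'
  rw [← sq_mul_invGain (σ := σ) h k]
  field_simp

/-- Every feasible point satisfies the scalar constraints in its signal-to-noise ratios. -/
lemma Feasible.ratio_lt_one_and_le (h : IsReducedSVD H U lam V) (hσ : 0 < σ) {P R : ℝ}
    {S : Matrix (Fin NT) (Fin NT) ℂ} (hf : Feasible H P σ R S ρ) :
    (0 < R → ρ < 1) ∧
    R * Real.log 2 ≤ ∑ k, Real.log (1 + (1 - ρ) * channelPower V S k / invGain lam σ k) ∧
    ∑ k, invGain lam σ k * ((1 - ρ) * channelPower V S k / invGain lam σ k) ≤ (1 - ρ) * P := by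
  have hlog2 := Real.log_pos one_lt_two
  have hle := (mul_le_mul_of_nonneg_right hf.rate_ge hlog2.le).trans
    (rate_le h hσ hf.ratio_mem.2 hf.psd).1
  refine ⟨fun hR => lt_of_le_of_ne hf.ratio_mem.2 fun h1 => ?_, hle, ?_⟩
  · subst h1
    have : 0 < R * Real.log 2 := mul_pos hR hlog2
    simp at hle
    linarith
  · have : ∀ k, invGain lam σ k * ((1 - ρ) * channelPower V S k / invGain lam σ k)
        = (1 - ρ) * channelPower V S k := fun k => mul_div_cancel₀ _ (invGain_pos h hσ k).ne'
    simp only [this]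
    rw [← Finset.mul_sum]
    exact mul_le_mul_of_nonneg_left ((sum_channelPower_le h hf.psd).1.trans hf.power_le)
      (by linarith [hf.ratio_mem.2])

variable {P R x μ ν : ℝ} {d : Fin r → ℝ}

lemma snr_of_mul_eq (h : IsReducedSVD H U lam V) (hσ : 0 < σ)
    (hp : ∀ k, x * p k = invGain lam σ k * d k) (k : Fin r) :
    (1 - (1 - x)) * p k / invGain lam σ k = d k := by
  rw [sub_sub_cancel, hp, mul_div_cancel_left₀ _ (invGain_pos h hσ k).ne']

lemma recvPower_of_mul_eq (h : IsReducedSVD H U lam V) (hσ : 0 < σ) (hx : x ≠ 0)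
    (hp : ∀ k, x * p k = invGain lam σ k * d k) :
    recvPower H (covOfPowers V p) = σ ^ 2 / x * ∑ k, d k := by
  rw [recvPower_covOfPowers h, sum_sq_mul_eq h hσ hx]
  congr 1
  refine Finset.sum_congr rfl fun k _ => ?_
  rw [hp, mul_div_cancel_left₀ _ (invGain_pos h hσ k).ne']

lemma rateSlope_of_mul_eq (h : IsReducedSVD H U lam V) (hσ : 0 < σ) (hx : 0 < x)
    (hp0 : ∀ k, 0 ≤ p k) (hp : ∀ k, x * p k = invGain lam σ k * d k) :
    rateSlope H σ (covOfPowers V p) (1 - x) = 1 / (x * Real.log 2) * ∑ k, d k / (1 + d k) := by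
  rw [rateSlope_covOfPowers h hp0 (by linarith), Finset.mul_sum, Finset.mul_sum]
  refine Finset.sum_congr rfl fun k _ => ?_
  rw [snr_of_mul_eq h hσ hp, mul_div_assoc', mul_div_assoc']
  congr 1
  have h1 : x * (lam k ^ 2 * p k) = σ ^ 2 * d k := by
    rw [← sq_mul_invGain (σ := σ) h k]
    linear_combination lam k ^ 2 * hp k
  have hlog2 := Real.log_pos one_lt_two
  field_simp
  linarith

lemma channelGrad_of_mul_eq (h : IsReducedSVD H U lam V) (hσ : 0 < σ)
    (hp : ∀ k, x * p k = invGain lam σ k * d k) (k : Fin r) :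
    channelGrad lam σ p (1 - x) μ k
      = lam k ^ 2 * (μ * x / (σ ^ 2 * Real.log 2) * (1 + d k)⁻¹ + (1 - x)) := by
  rw [channelGrad, snr_of_mul_eq h hσ hp, sub_sub_cancel]
  ring

namespace IsStationary

lemma power_nonneg (h : IsReducedSVD H U lam V) (hσ : 0 < σ)
    (hs : IsStationary lam P σ R x μ ν d) (hp : ∀ k, x * p k = invGain lam σ k * d k)
    (k : Fin r) : 0 ≤ p k :=
  nonneg_of_mul_nonneg_right
    (by rw [hp]; exact mul_nonneg (invGain_pos h hσ k).le (hs.level.nonneg k)) hs.x_pos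

lemma rate_eq (h : IsReducedSVD H U lam V) (hσ : 0 < σ)
    (hs : IsStationary lam P σ R x μ ν d) (hp : ∀ k, x * p k = invGain lam σ k * d k) :
    SWIPT.rate H σ (covOfPowers V p) (1 - x) = R := by
  have h1 := rate_covOfPowers h (hs.power_nonneg h hσ hp) (σ := σ) (ρ := 1 - x)
    (by linarith [hs.x_pos])
  simp only [snr_of_mul_eq h hσ hp] at h1
  rw [hs.rate] at h1
  exact mul_right_cancel₀ (Real.log_pos one_lt_two).ne' h1

lemma sum_power (hs : IsStationary lam P σ R x μ ν d)
    (hp : ∀ k, x * p k = invGain lam σ k * d k) : ∑ k, p k = P := by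
  have h1 := hs.power
  simp only [← hp] at h1
  rw [← Finset.mul_sum] at h1
  exact mul_left_cancel₀ hs.x_pos.ne' h1

lemma feasible (h : IsReducedSVD H U lam V) (hσ : 0 < σ)
    (hs : IsStationary lam P σ R x μ ν d) (hp : ∀ k, x * p k = invGain lam σ k * d k) :
    Feasible H P σ R (covOfPowers V p) (1 - x) where
  rate_ge := (hs.rate_eq h hσ hp).ge
  power_le := by rw [trace_covOfPowers h, hs.sum_power hp]
  psd := covOfPowers_posSemidef (hs.power_nonneg h hσ hp)
  ratio_mem := ⟨by linarith [hs.x_le], by linarith [hs.x_pos]⟩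

/-- The first-order conditions contain stationarity in `ρ`. -/
lemma mu_mul_sum (hs : IsStationary lam P σ R x μ ν d) :
    μ * ∑ k, d k / (1 + d k) = Real.log 2 * (σ ^ 2 * ∑ k, d k) := by
  have hx := hs.x_pos
  have hμ := hs.mu_pos
  rw [hs.level.sum_div, hs.power]
  have h1 : μ * (Real.log 2 * ν / (x * μ) * (x * P)
      - Real.log 2 * σ ^ 2 * (1 - x) / (x * μ) * ∑ k, d k)
      = Real.log 2 * (ν * (x * P) - (1 - x) * (σ ^ 2 * ∑ k, d k)) / x := by
    field_simp
  rw [h1, hs.balance]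
  field_simp
  ring

lemma level_eq (h : IsReducedSVD H U lam V) (hσ : 0 < σ)
    (hs : IsStationary lam P σ R x μ ν d) (k : Fin r) :
    lam k ^ 2 * (μ * x / (σ ^ 2 * Real.log 2) * (Real.log 2 * ν / (x * μ) * invGain lam σ k
      - Real.log 2 * σ ^ 2 * (1 - x) / (x * μ)) + (1 - x)) = ν := by
  have hx := hs.x_pos
  have hμ := hs.mu_pos
  have hl := h.pos k
  have hlog2 := Real.log_pos one_lt_two
  rw [invGain]
  field_simp
  ring

theorem isKKTPoint (h : IsReducedSVD H U lam V) (hσ : 0 < σ)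
    (hs : IsStationary lam P σ R x μ ν d) (hp : ∀ k, x * p k = invGain lam σ k * d k) :
    IsKKTPoint H P σ R (covOfPowers V p) (1 - x) μ ν := by
  have hx := hs.x_pos
  have hμ := hs.mu_pos
  have hlog2 := Real.log_pos one_lt_two
  have hp0 := hs.power_nonneg h hσ hp
  refine isKKTPoint_covOfPowers h hp0 (hs.feasible h hσ hp) hμ.le hs.nu_pos.le
    (fun k => ?_) (fun k hk => ?_) ?_ (hs.rate_eq h hσ hp) (hs.sum_power hp)
  · rw [channelGrad_of_mul_eq h hσ hp, ← hs.level_eq h hσ k]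
    refine mul_le_mul_of_nonneg_left (add_le_add_left
      (mul_le_mul_of_nonneg_left (hs.level.le k) (by positivity)) _) (sq_nonneg _)
  · have hdk : d k ≠ 0 := fun h0 => hk <| by
      have := hp k
      rw [h0, mul_zero] at this
      exact (mul_eq_zero.1 this).resolve_left hx.ne'
    rw [channelGrad_of_mul_eq h hσ hp, hs.level.eq k hdk, hs.level_eq h hσ k]
  · rw [rateSlope_of_mul_eq h hσ hx hp0 hp, recvPower_of_mul_eq h hσ hx.ne' hp]
    have := hs.mu_mul_sum
    field_simp
    linarith

theorem isGlobalOptimum_unique (h : IsReducedSVD H U lam V) (hσ : 0 < σ) (hP : 0 < P)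
    (hR : 0 < R) (hs : IsStationary lam P σ R x μ ν d)
    (hp : ∀ k, x * p k = invGain lam σ k * d k) :
    IsGlobalOptimum H P σ R (covOfPowers V p) (1 - x) ∧
      ∀ (S : Matrix (Fin NT) (Fin NT) ℂ) (ρ' : ℝ), IsGlobalOptimum H P σ R S ρ' →
        S = covOfPowers V p ∧ ρ' = 1 - x := by
  have hx := hs.x_pos
  have hμ := hs.mu_pos
  have hν := hs.nu_pos
  have hx1 := hs.x_le
  have hlog2 := Real.log_pos one_lt_two
  have hp0 := hs.power_nonneg h hσ hp
  have hf := hs.feasible h hσ hp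
  have hb := invGain_pos h hσ
  have hxP : 0 < x * P := mul_pos hx hP
  have hR2 : 0 < R * Real.log 2 := mul_pos hR hlog2
  have hval : harvest H (covOfPowers V p) (1 - x)
      = σ ^ 2 * ((P - x * P) / (x * P) * ∑ k, d k) := by
    rw [harvest, recvPower_of_mul_eq h hσ hx.ne' hp]
    field_simp
  -- the scalar comparison applied to the signal-to-noise ratios of a feasible point
  have key : ∀ (S : Matrix (Fin NT) (Fin NT) ℂ) (ρ' : ℝ), Feasible H P σ R S ρ' →
      harvest H S ρ' ≤ harvest H (covOfPowers V p) (1 - x) ∧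
      (harvest H (covOfPowers V p) (1 - x) ≤ harvest H S ρ' →
        (fun k => (1 - ρ') * channelPower V S k / invGain lam σ k) = d ∧ 1 - ρ' = x) := by
    intro S ρ' hS
    obtain ⟨h1, h2, h3⟩ := hS.ratio_lt_one_and_le h hσ
    have hρ := h1 hR
    have hx' : 0 < 1 - ρ' := by linarith
    have hhar : harvest H S ρ' = σ ^ 2 * ((1 - (1 - ρ')) / (1 - ρ') *
        ∑ k, (1 - ρ') * channelPower V S k / invGain lam σ k) := by
      rw [harvest, recvPower_eq h, sum_sq_mul_eq h hσ hx'.ne']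
      ring
    have hmain := hs.level.harvest_le (P := P) (x := 1 - ρ')
      (e := fun k => (1 - ρ') * channelPower V S k / invGain lam σ k) hb
      (div_nonneg (mul_nonneg (by positivity) (by linarith)) (by positivity))
      (by positivity) (by rw [hs.rate]; exact hR2) hP
      (by rw [hs.power]; nlinarith)
      (by
        rw [hs.power]
        field_simp
        linear_combination (1 - x) * hs.balance)
      (fun k => div_nonneg (mul_nonneg hx'.le (channelPower_nonneg hS.psd k)) (hb k).le)
      hx' (by linarith [hS.ratio_mem.1]) h3 (by rw [hs.rate]; exact h2)
    rw [hs.power] at hmain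
    rw [hval, hhar]
    refine ⟨mul_le_mul_of_nonneg_left hmain.1 (sq_nonneg σ), fun hle => ?_⟩
    obtain ⟨h4, h5⟩ := hmain.2 (le_of_mul_le_mul_left hle (pow_pos hσ 2))
    refine ⟨h4, ?_⟩
    rw [h5, mul_div_cancel_right₀ _ hP.ne']
  refine ⟨⟨hf, fun S ρ' hS => (key S ρ' hS).1⟩, fun S ρ' hS => ?_⟩
  obtain ⟨h1, h2⟩ := (key S ρ' hS.1).2 (hS.2 _ _ hf)
  have hρ : ρ' = 1 - x := by linarith
  subst hρ
  refine ⟨?_, rfl⟩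
  have hq : channelPower V S = p := by
    funext k
    have h3 := congrFun h1 k
    have h4 := hp k
    rw [← h3, mul_div_cancel₀ _ (hb k).ne', sub_sub_cancel] at h4
    exact (mul_left_cancel₀ hx.ne' h4).symm
  -- the rate constraint is tight, so Hadamard's inequality is an equality
  have h5 : Vᴴ * S * V = Matrix.diagonal fun k => (channelPower V S k : ℂ) := by
    refine (rate_le h hσ hS.1.ratio_mem.2 hS.1.psd).2 ?_ (by linarith)
    have h6 := hs.rate
    rw [← h1] at h6
    rw [h6]
    exact mul_le_mul_of_nonneg_right hS.1.rate_ge hlog2.le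
  have h7 := (sum_channelPower_le h hS.1.psd).2
    (by rw [hq, hs.sum_power hp]; exact hS.1.power_le)
  rw [h7, h5, hq, covOfPowers]

end IsStationary

end KKT

/-! ### Waterfilling -/

section Waterfilling

variable {NR NT r : ℕ} {H : Matrix (Fin NR) (Fin NT) ℂ} {U : Matrix (Fin NR) (Fin r) ℂ}
  {lam : Fin r → ℝ} {V : Matrix (Fin NT) (Fin r) ℂ} {P σ R : ℝ}

lemma noiseGain_succ (lam : Fin r → ℝ) (σ : ℝ) (k : Fin r) :
    noiseGain lam σ ((k : ℕ) + 1) = invGain lam σ k := by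
  simp [noiseGain, invGain]

lemma invGain_mono (h : IsReducedSVD H U lam V) (σ : ℝ) : Monotone (invGain lam σ) :=
  fun _ k hjk => div_le_div_of_nonneg_left (sq_nonneg σ) (pow_pos (h.pos k) 2)
    (pow_le_pow_left₀ (h.pos k).le (h.anti hjk) 2)

lemma wfSlack_succ (lam : Fin r → ℝ) (P σ : ℝ) (m : ℕ) :
    wfSlack lam P σ (m + 1)
      = P + ∑ i ∈ Finset.range m, noiseGain lam σ (i + 1) - m * noiseGain lam σ (m + 1) := by
  rw [wfSlack, Finset.sum_Ico_eq_sum_range, Finset.sum_sub_distrib]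
  simp [add_comm 1]
  ring

/-- The waterfilling powers belong to a constant water level and exhaust the power budget. -/
theorem exists_isWaterLevel_wfPower (h : IsReducedSVD H U lam V) (hr : 0 < r) (hσ : 0 < σ)
    (hP : 0 < P) : ∃ L : ℝ, 0 < L ∧
      IsWaterLevel (invGain lam σ) L⁻¹ 0 (fun k => wfPower lam P σ k / invGain lam σ k) ∧
      ∑ k, wfPower lam P σ k = P := by
  set A := {k : ℕ | 0 < max 0 (wfSlack lam P σ k) ∧ 1 ≤ k ∧ k ≤ r} with hA
  have hb := invGain_pos h hσ
  have hbdd : BddAbove A := ⟨r, fun k hk => hk.2.2⟩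
  have hne : A.Nonempty := ⟨1, by simp [hA, wfSlack, hP]; omega⟩
  have hmem : wfRank lam P σ ∈ A := Nat.sSup_mem hne hbdd
  have hmax : ∀ k ∈ A, k ≤ wfRank lam P σ := fun k hk => le_csSup hbdd hk
  obtain ⟨m, hm⟩ : ∃ m, wfRank lam P σ = m + 1 :=
    ⟨wfRank lam P σ - 1, by have := hmem.2.1; omega⟩
  rw [hm] at hmem hmax
  obtain ⟨hs0, -, hmr⟩ := hmem
  have hs : 0 < wfSlack lam P σ (m + 1) := by simpa using hs0
  set n : ℕ → ℝ := fun i => noiseGain lam σ (i + 1) with hn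
  have hnk : ∀ k : Fin r, n k = invGain lam σ k := noiseGain_succ lam σ
  set L := wfSlack lam P σ (m + 1) / ((m + 1 : ℕ) : ℝ) + n m with hL
  have hm1 : (0 : ℝ) < ((m + 1 : ℕ) : ℝ) := by positivity
  have hmL : ((m + 1 : ℕ) : ℝ) * L = P + ∑ i ∈ Finset.range (m + 1), n i := by
    rw [hL, mul_add, mul_div_cancel₀ _ hm1.ne', wfSlack_succ, Finset.sum_range_succ]
    push_cast
    ring
  have hpow : ∀ k : Fin r, wfPower lam P σ k = if (k : ℕ) < m + 1 then L - n k else 0 := by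
    intro k
    rw [wfPower, hm]
    rfl
  have hnm : n m < L := by
    have := div_pos hs hm1
    linarith
  have hlow : ∀ k : Fin r, (k : ℕ) < m + 1 → invGain lam σ k < L := fun k hk => by
    refine lt_of_le_of_lt ?_ hnm
    have := hnk ⟨m, by omega⟩
    simp only at this
    rw [this]
    exact invGain_mono h σ (Fin.le_def.2 (by simp only; omega))
  -- maximality of the rank: the next channel is not worth using
  have hhigh : ∀ k : Fin r, ¬ (k : ℕ) < m + 1 → L ≤ invGain lam σ k := fun k hk => by
    have hmr' : m + 1 < r := by omega
    have h1 : wfSlack lam P σ (m + 1 + 1) ≤ 0 := by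
      by_contra hc
      have := hmax (m + 1 + 1) ⟨by simpa using hc, by omega, by omega⟩
      omega
    rw [wfSlack_succ] at h1
    have h2 : ((m + 1 : ℕ) : ℝ) * L ≤ ((m + 1 : ℕ) : ℝ) * n (m + 1) := by
      rw [hmL]
      linarith
    refine (le_of_mul_le_mul_left h2 hm1).trans ?_
    have := hnk ⟨m + 1, hmr'⟩
    simp only at this
    rw [this]
    exact invGain_mono h σ (Fin.le_def.2 (by simp only; omega))
  have hL0 : 0 < L := (hb ⟨0, hr⟩).trans (hlow ⟨0, hr⟩ (by simp))
  refine ⟨L, hL0, ⟨fun k => ?_, fun k => ?_, fun k hk => ?_⟩, ?_⟩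
  · refine div_nonneg ?_ (hb k).le
    rw [hpow]
    split_ifs with hk
    · rw [hnk]
      linarith [hlow k hk]
    · exact le_rfl
  · rw [hpow]
    have := (hb k).ne'
    split_ifs with hk
    · refine le_of_eq ?_
      rw [hnk, sub_div, div_self this, add_sub_cancel, inv_div, inv_mul_eq_div, sub_zero]
    · rw [zero_div, add_zero, inv_one, sub_zero, inv_mul_eq_div, one_le_div hL0]
      exact hhigh k hk
  · rw [hpow] at hk ⊢
    have := (hb k).ne'
    split_ifs at hk ⊢ with hk'
    · rw [hnk, sub_div, div_self this, add_sub_cancel, inv_div, inv_mul_eq_div, sub_zero]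
    · simp at hk
  · simp only [hpow]
    rw [Fin.sum_univ_eq_sum_range (fun k => if k < m + 1 then L - n k else 0) r,
      ← Finset.sum_filter]
    have : (Finset.range r).filter (fun k => k < m + 1) = Finset.range (m + 1) := by
      ext k
      simp only [Finset.mem_filter, Finset.mem_range]
      omega
    rw [this, Finset.sum_sub_distrib, Finset.sum_const, Finset.card_range, nsmul_eq_mul, hmL]
    ring

lemma wfPower_nonneg (h : IsReducedSVD H U lam V) (hr : 0 < r) (hσ : 0 < σ) (hP : 0 < P)
    (k : Fin r) : 0 ≤ wfPower lam P σ k := by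
  obtain ⟨L, -, hw, -⟩ := exists_isWaterLevel_wfPower h hr hσ hP
  have := mul_nonneg (hw.nonneg k) (invGain_pos h hσ k).le
  rwa [div_mul_cancel₀ _ (invGain_pos h hσ k).ne'] at this

lemma rateMax_eq (h : IsReducedSVD H U lam V) (hr : 0 < r) (hσ : 0 < σ) (hP : 0 < P) :
    rateMax H lam V P σ * Real.log 2
      = ∑ k, Real.log (1 + wfPower lam P σ k / invGain lam σ k) := by
  have := rate_covOfPowers h (wfPower_nonneg h hr hσ hP) (σ := σ) (ρ := 0) zero_le_one
  rw [rateMax, this]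
  simp

lemma sum_invGain_mul (h : IsReducedSVD H U lam V) (hσ : 0 < σ) (q : Fin r → ℝ) :
    ∑ k, invGain lam σ k * (q k / invGain lam σ k) = ∑ k, q k :=
  Finset.sum_congr rfl fun k _ => mul_div_cancel₀ _ (invGain_pos h hσ k).ne'

/-- Waterfilling attains the largest rate. -/
theorem Feasible.le_rateMax (h : IsReducedSVD H U lam V) (hr : 0 < r) (hσ : 0 < σ) (hP : 0 < P)
    {S : Matrix (Fin NT) (Fin NT) ℂ} {ρ : ℝ} (hf : Feasible H P σ R S ρ) :
    R ≤ rateMax H lam V P σ := by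
  obtain ⟨L, hL, hw, hsum⟩ := exists_isWaterLevel_wfPower h hr hσ hP
  obtain ⟨-, h2, h3⟩ := hf.ratio_lt_one_and_le h hσ
  have h4 := hw.sum_log_le
    (e := fun k => (1 - ρ) * channelPower V S k / invGain lam σ k)
    (snr_nonneg (channelPower_nonneg hf.psd) hf.ratio_mem.2)
  rw [← rateMax_eq h hr hσ hP, sum_invGain_mul h hσ (wfPower lam P σ), hsum] at h4
  have h5 : (1 - ρ) * P ≤ P := by nlinarith [hf.ratio_mem.1]
  have h6 : L⁻¹ * (∑ k, invGain lam σ k * ((1 - ρ) * channelPower V S k / invGain lam σ k) - P)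
      ≤ 0 := mul_nonpos_of_nonneg_of_nonpos (inv_pos.2 hL).le (by linarith)
  exact le_of_mul_le_mul_right (by linarith) (Real.log_pos one_lt_two)

end Waterfilling

/-! ### Spatial multiplexing -/

section Multiplexing

variable {NR NT r : ℕ} {H : Matrix (Fin NR) (Fin NT) ℂ} {U : Matrix (Fin NR) (Fin r) ℂ}
  {lam : Fin r → ℝ} {V : Matrix (Fin NT) (Fin r) ℂ} {P σ R x μ ν : ℝ} {d : Fin r → ℝ}

lemma IsWaterLevel.eq_inv_min {ι : Type*} {b d : ι → ℝ} {α β : ℝ} (h : IsWaterLevel b α β d)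
    (k : ι) : d k = (min 1 (α * b k - β))⁻¹ - 1 := by
  have h1 := h.le k
  by_cases hk : d k = 0
  · rw [hk] at h1
    rw [hk, min_eq_left (by simpa using h1)]
    simp
  · rw [← h.eq k hk, min_eq_right (inv_le_one_of_one_le₀ (by linarith [h.nonneg k])), inv_inv]
    ring

lemma level_eq_mul (h : IsReducedSVD H U lam V) (hx : 0 < x) (hμ : 0 < μ) (k : Fin r) :
    Real.log 2 * ν / (x * μ) * invGain lam σ k - Real.log 2 * σ ^ 2 * (1 - x) / (x * μ)
      = Real.log 2 * σ ^ 2 / (x * μ * lam k ^ 2) * (ν - (1 - x) * lam k ^ 2) := by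
  have := h.pos k
  rw [invGain]
  field_simp

/-- The modified waterfilling powers are those of the water level of `IsStationary`. -/
lemma mul_powerSM (h : IsReducedSVD H U lam V) (hσ : 0 < σ) (hx : 0 < x) (hμ : 0 < μ)
    {k : Fin r} (hk : (1 - x) * lam k ^ 2 < ν) :
    x * powerSM lam σ (1 - x) μ ν k = invGain lam σ k *
      ((min 1 (Real.log 2 * ν / (x * μ) * invGain lam σ k
        - Real.log 2 * σ ^ 2 * (1 - x) / (x * μ)))⁻¹ - 1) := by
  have hl := h.pos k
  have hlog2 := Real.log_pos one_lt_two
  have hb := invGain_pos h hσ k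
  rw [level_eq_mul h hx hμ]
  set w := ν - (1 - x) * lam k ^ 2 with hw
  have hw0 : 0 < w := by linarith
  set z := Real.log 2 * σ ^ 2 / (x * μ * lam k ^ 2) * w with hz
  have hz0 : 0 < z := by positivity
  have h1 : x * (μ / (Real.log 2 * w) - σ ^ 2 / (x * lam k ^ 2))
      = invGain lam σ k * (z⁻¹ - 1) := by
    rw [hz, invGain]
    field_simp
  rw [powerSM, sub_sub_cancel, mul_max_of_nonneg _ _ hx.le, mul_zero, h1]
  rcases le_total z 1 with hz1 | hz1
  · rw [min_eq_right hz1, max_eq_right]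
    exact mul_nonneg hb.le (sub_nonneg.2 ((one_le_inv₀ hz0).2 hz1))
  · rw [min_eq_left hz1, inv_one, sub_self, mul_zero, max_eq_left]
    exact mul_nonpos_of_nonneg_of_nonpos hb.le
      (sub_nonpos.2 (inv_le_one_of_one_le₀ hz1))

lemma IsStationary.level_pos (h : IsReducedSVD H U lam V) (hσ : 0 < σ)
    (hs : IsStationary lam P σ R x μ ν d) (k : Fin r) : (1 - x) * lam k ^ 2 < ν := by
  have h1 := hs.level.pos k
  rw [level_eq_mul h hs.x_pos hs.mu_pos] at h1
  have := h.pos k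
  have := hs.x_pos
  have := hs.mu_pos
  have := Real.log_pos one_lt_two
  exact sub_pos.1 (pos_of_mul_pos_right h1 (by positivity))

lemma IsStationary.mul_powerSM (h : IsReducedSVD H U lam V) (hσ : 0 < σ)
    (hs : IsStationary lam P σ R x μ ν d) (k : Fin r) :
    x * powerSM lam σ (1 - x) μ ν k = invGain lam σ k * d k := by
  rw [SWIPT.mul_powerSM h hσ hs.x_pos hs.mu_pos (hs.level_pos h hσ k), hs.level.eq_inv_min k]

theorem IsStationary.solvesSystem (h : IsReducedSVD H U lam V) (hσ : 0 < σ) (hP : 0 < P)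
    (hs : IsStationary lam P σ R x μ ν d) : SolvesSystem H lam V P σ R (1 - x) μ ν where
  ratio_mem := ⟨by linarith [hs.x_le], by linarith [hs.x_pos]⟩
  mu_pos := hs.mu_pos
  nu_pos := hs.nu_pos
  level_pos := hs.level_pos h hσ
  slack_rate := by
    rw [covSM, hs.rate_eq h hσ (hs.mul_powerSM h hσ), sub_self, mul_zero]
  slack_power := by
    rw [covSM, trace_covOfPowers h, hs.sum_power (hs.mul_powerSM h hσ), sub_self, mul_zero]
  stat_ρ := by
    have hp := hs.mul_powerSM h hσ
    have hx := hs.x_pos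
    have hμ := hs.mu_pos
    have hlog2 := Real.log_pos one_lt_two
    have hD : 0 < σ ^ 2 * ∑ k, d k := by
      rw [hs.balance]
      exact mul_pos hs.nu_pos (mul_pos hx hP)
    have h1 := hs.mu_mul_sum
    have hF : 0 < ∑ k, d k / (1 + d k) := by
      refine pos_of_mul_pos_right ?_ hμ.le
      rw [h1]
      exact mul_pos hlog2 hD
    rw [covSM, rateSlope_of_mul_eq h hσ hx (hs.power_nonneg h hσ hp) hp,
      recvPower_of_mul_eq h hσ hx.ne' hp, eq_div_iff (by positivity)]
    field_simp
    linarith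

theorem SolvesSystem.exists_isStationary {ρ : ℝ} (h : IsReducedSVD H U lam V) (hσ : 0 < σ)
    (hs : SolvesSystem H lam V P σ R ρ μ ν) :
    ∃ d, IsStationary lam P σ R (1 - ρ) μ ν d := by
  obtain ⟨x, rfl⟩ : ∃ x, ρ = 1 - x := ⟨1 - ρ, by ring⟩
  rw [sub_sub_cancel]
  have hx : 0 < x := by linarith [hs.ratio_mem.2]
  have hμ := hs.mu_pos
  have hlog2 := Real.log_pos one_lt_two
  have hlev := isWaterLevel_of_pos (b := invGain lam σ) (α := Real.log 2 * ν / (x * μ))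
    (β := Real.log 2 * σ ^ 2 * (1 - x) / (x * μ)) fun k => by
      rw [level_eq_mul h hx hμ]
      have := h.pos k
      exact mul_pos (by positivity) (sub_pos.2 (hs.level_pos k))
  have hp := fun k => SWIPT.mul_powerSM h hσ hx hμ (hs.level_pos k)
  set d : Fin r → ℝ := fun k => (min 1 (Real.log 2 * ν / (x * μ) * invGain lam σ k
        - Real.log 2 * σ ^ 2 * (1 - x) / (x * μ)))⁻¹ - 1 with hd
  have hp' : ∀ k, x * powerSM lam σ (1 - x) μ ν k = invGain lam σ k * d k := hp
  have hp0 : ∀ k, 0 ≤ powerSM lam σ (1 - x) μ ν k := fun k => le_max_left _ _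
  have hrate : R = rate H σ (covSM lam V σ (1 - x) μ ν) (1 - x) :=
    sub_eq_zero.1 ((mul_eq_zero.1 hs.slack_rate).resolve_left hμ.ne')
  have hpow : ∑ k, powerSM lam σ (1 - x) μ ν k = P := by
    rw [← trace_covOfPowers h]
    exact sub_eq_zero.1 ((mul_eq_zero.1 hs.slack_power).resolve_left hs.nu_pos.ne')
  have hpower : ∑ k, invGain lam σ k * d k = x * P := by
    rw [← hpow, Finset.mul_sum]
    exact Finset.sum_congr rfl fun k _ => (hp' k).symm
  refine ⟨d, hx, by linarith [hs.ratio_mem.1], hμ, hs.nu_pos, hlev, ?_, hpower, ?_⟩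
  · rw [hrate, covSM, rate_covOfPowers h hp0 (by linarith)]
    exact Finset.sum_congr rfl fun k _ => by rw [snr_of_mul_eq h hσ hp']
  · have h1 := hs.stat_ρ
    rw [covSM, rateSlope_of_mul_eq h hσ hx hp0 hp',
      recvPower_of_mul_eq h hσ hx.ne' hp', hlev.sum_div, hpower] at h1
    -- a zero denominator would make the quotient, hence `μ`, vanish
    have h2 : 1 / (x * Real.log 2) * (Real.log 2 * ν / (x * μ) * (x * P)
        - Real.log 2 * σ ^ 2 * (1 - x) / (x * μ) * ∑ k, d k) ≠ 0 := fun h0 => by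
      rw [h0, div_zero] at h1
      exact hμ.ne' h1
    rw [eq_div_iff h2] at h1
    field_simp at h1
    linarith

theorem exists_isStationary (h : IsReducedSVD H U lam V) (hr : 0 < r) (hσ : 0 < σ) (hP : 0 < P)
    (hR : 0 < R) (hmax : R ≤ rateMax H lam V P σ) :
    ∃ (x μ ν : ℝ) (d : Fin r → ℝ), IsStationary lam P σ R x μ ν d := by
  have hlog2 := Real.log_pos one_lt_two
  have hb := invGain_pos h hσ
  have hT : 0 < R * Real.log 2 := mul_pos hR hlog2
  obtain ⟨L, -, hw, hsum⟩ := exists_isWaterLevel_wfPower h hr hσ hP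
  obtain ⟨α, β, d, hα, hβ, hd, hrate, hsP, hst⟩ := exists_isWaterLevel hb ⟨0, hr⟩
    (fun k => invGain_mono h σ (Fin.le_def.2 (Nat.zero_le _))) hP hT hw.nonneg
    (by rw [sum_invGain_mul h hσ (wfPower lam P σ), hsum])
    (by rw [← rateMax_eq h hr hσ hP]; exact mul_le_mul_of_nonneg_right hmax hlog2.le)
  have hD : 0 < ∑ k, d k := by
    by_contra hc
    have := sum_log_nonpos_of_sum_nonpos hd.nonneg (not_lt.1 hc)
    linarith
  have hs : 0 < ∑ k, invGain lam σ k * d k := by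
    obtain ⟨k, _, hk⟩ := Finset.exists_lt_of_sum_lt (s := Finset.univ) (f := fun _ => (0 : ℝ))
      (g := d) (by simpa using hD)
    exact Finset.sum_pos' (fun i _ => mul_nonneg (hb i).le (hd.nonneg i))
      ⟨k, Finset.mem_univ k, mul_pos (hb k) hk⟩
  set s := ∑ k, invGain lam σ k * d k with hsdef
  set D := ∑ k, d k with hDdef
  have hν : 0 < σ ^ 2 * D / s := by positivity
  refine ⟨s / P, Real.log 2 * (σ ^ 2 * D / s) / (α * (s / P)), σ ^ 2 * D / s, d,
    div_pos hs hP, (div_le_one hP).2 hsP, by positivity, hν, ?_, hrate, ?_, ?_⟩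
  · convert hd using 1
    · field_simp
    · field_simp
      linarith
  · rw [div_mul_cancel₀ _ hP.ne']
  · rw [div_mul_cancel₀ _ hP.ne', div_mul_cancel₀ _ hs.ne']

end Multiplexing

/-! ### Energy beamforming and the rate threshold -/

section Beamforming

variable {NR NT r : ℕ} {H : Matrix (Fin NR) (Fin NT) ℂ} {U : Matrix (Fin NR) (Fin r) ℂ}
  {lam : Fin r → ℝ} {V : Matrix (Fin NT) (Fin r) ℂ} {P σ R x μ ν : ℝ} {d : Fin r → ℝ}

lemma covEB_eq (V : Matrix (Fin NT) (Fin r) ℂ) (i : Fin r) (P : ℝ) :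
    covEB (V.col i) P = covOfPowers V (Pi.single i P) := by
  ext j l
  rw [covEB, covOfPowers, Matrix.mul_apply, Finset.sum_eq_single i]
  · simp [Matrix.vecMulVec_apply, Matrix.mul_diagonal]
    ring
  · intro k _ hk
    simp [Matrix.mul_diagonal, hk]
  · simp

/-- The threshold as a quadratic inequality for the signal-to-noise ratio `2 ^ R - 1` of energy
beamforming. -/
lemma le_rateThreshold_iff {l1 l2 : ℝ} (h2 : 0 < l2) (h21 : l2 ≤ l1) (hP : 0 < P) (hσ : 0 < σ)
    (hR : 0 ≤ R) : R ≤ rateThreshold l1 l2 P σ ↔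
      ((2 : ℝ) ^ R - 1) ^ 2 * (l2 ^ 2 * σ ^ 2) ≤ l1 ^ 2 * P * (l1 ^ 2 - l2 ^ 2) := by
  have h1 : 0 < l1 := h2.trans_le h21
  have hd : 0 ≤ l1 ^ 2 - l2 ^ 2 := sub_nonneg.2 (pow_le_pow_left₀ h2.le h21 2)
  have hy : 0 ≤ (2 : ℝ) ^ R - 1 := sub_nonneg.2 (Real.one_le_rpow one_le_two hR)
  have hA : (l1 ^ 2 - l2 ^ 2) * (l1 ^ 2 * P + 0 * l2 ^ 2) ^ 2 / (l1 ^ 2 * l2 ^ 2 * σ ^ 2 * P)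
      = l1 ^ 2 * P * (l1 ^ 2 - l2 ^ 2) / (l2 ^ 2 * σ ^ 2) := by
    field_simp
    ring
  rw [rateThreshold, rateThresholdAt, hA, zero_mul, zero_div, add_zero,
    Real.le_logb_iff_rpow_le one_lt_two (by positivity), ← sub_le_iff_le_add',
    Real.le_sqrt hy, le_div_iff₀ (by positivity)]
  exact div_nonneg (mul_nonneg (by positivity) hd) (by positivity)

lemma log_two_rpow (R : ℝ) : Real.log (1 + ((2 : ℝ) ^ R - 1)) = R * Real.log 2 := by
  rw [add_sub_cancel, Real.log_rpow two_pos]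

/-- The threshold as the condition that energy beamforming with splitting `x` leaves the gradient
of the Lagrangian nonpositive on the second channel. -/
lemma le_rateThreshold_iff_of_mul_eq (h : IsReducedSVD H U lam V) (hσ : 0 < σ) (hP : 0 < P)
    (hR : 0 ≤ R) {i₁ i₂ : Fin r} (h12 : lam i₂ ≤ lam i₁)
    (hxP : x * P = invGain lam σ i₁ * ((2 : ℝ) ^ R - 1)) :
    R ≤ rateThreshold (lam i₁) (lam i₂) P σ ↔
      lam i₂ ^ 2 * (1 + x * ((2 : ℝ) ^ R - 1)) ≤ lam i₁ ^ 2 := by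
  have hl1 := h.pos i₁
  have hpos : 0 < lam i₁ ^ 2 * P := by positivity
  have h1 : ((2 : ℝ) ^ R - 1) ^ 2 * (lam i₂ ^ 2 * σ ^ 2)
      = lam i₁ ^ 2 * P * (lam i₂ ^ 2 * (x * ((2 : ℝ) ^ R - 1))) := by
    rw [← sq_mul_invGain (σ := σ) h i₁]
    linear_combination -lam i₁ ^ 2 * lam i₂ ^ 2 * ((2 : ℝ) ^ R - 1) * hxP
  rw [le_rateThreshold_iff (h.pos i₂) h12 hP hσ hR, h1]
  refine ⟨fun h2 => ?_, fun h2 => mul_le_mul_of_nonneg_left (by linarith) hpos.le⟩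
  have := le_of_mul_le_mul_left h2 hpos
  linarith

/-- Below the threshold and below the maximal rate, energy beamforming attains the rate. -/
lemma invGain_mul_le_of_le (h : IsReducedSVD H U lam V) (hσ : 0 < σ) (hP : 0 < P) (hR : 0 ≤ R)
    {i₁ i₂ : Fin r} (hle : ∀ k, k ≠ i₁ → invGain lam σ i₂ ≤ invGain lam σ k)
    (h12 : lam i₂ ≤ lam i₁)
    (hth : R ≤ rateThreshold (lam i₁) (lam i₂) P σ) (hmax : R ≤ rateMax H lam V P σ) :
    invGain lam σ i₁ * ((2 : ℝ) ^ R - 1) ≤ P := by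
  have hlog2 := Real.log_pos one_lt_two
  have hr : 0 < r := i₁.pos
  have hb := invGain_pos h hσ
  rw [le_rateThreshold_iff (h.pos i₂) h12 hP hσ hR] at hth
  set y := (2 : ℝ) ^ R - 1 with hy
  have hy0 : 0 ≤ y := sub_nonneg.2 (Real.one_le_rpow one_le_two hR)
  by_contra! hcon
  have hb1 := hb i₁
  -- a failure would put the second channel above the waterfilling level of the first alone
  have hgap : P + invGain lam σ i₁ ≤ invGain lam σ i₂ := by
    have hl1 := h.pos i₁
    have hl2 := h.pos i₂
    have e1 := sq_mul_invGain (σ := σ) h i₁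
    have e2 := sq_mul_invGain (σ := σ) h i₂
    set b₁ := invGain lam σ i₁
    set b₂ := invGain lam σ i₂
    have h1 : (lam i₂ ^ 2 * lam i₁ ^ 2) * (y * b₁) ^ 2 ≤
        (lam i₂ ^ 2 * lam i₁ ^ 2) * (P * (b₂ - b₁)) := by
      have h2 : y ^ 2 * (lam i₂ ^ 2 * σ ^ 2) * b₁ ≤
          lam i₁ ^ 2 * P * (lam i₁ ^ 2 - lam i₂ ^ 2) * b₁ :=
        mul_le_mul_of_nonneg_right hth hb1.le
      have h3 : y ^ 2 * (lam i₂ ^ 2 * σ ^ 2) * b₁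
          = (lam i₂ ^ 2 * lam i₁ ^ 2) * (y * b₁) ^ 2 := by
        rw [← e1]; ring
      have h4 : lam i₁ ^ 2 * P * (lam i₁ ^ 2 - lam i₂ ^ 2) * b₁
          = (lam i₂ ^ 2 * lam i₁ ^ 2) * (P * (b₂ - b₁)) := by
        linear_combination lam i₁ ^ 2 * P * (e1 - e2)
      rw [h3, h4] at h2
      exact h2
    have h5 := le_of_mul_le_mul_left h1 (by positivity)
    have h6 : P * P ≤ (y * b₁) ^ 2 := by nlinarith
    have h7 : P * P ≤ P * (b₂ - b₁) := h6.trans h5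
    linarith [le_of_mul_le_mul_left h7 hP]
  obtain ⟨L, -, hw, hsum⟩ := exists_isWaterLevel_wfPower h hr hσ hP
  have hlev : IsWaterLevel (invGain lam σ) (P + invGain lam σ i₁)⁻¹ 0
      (Pi.single i₁ (P / invGain lam σ i₁)) := by
    have hne : (1 + P / invGain lam σ i₁)⁻¹
        = (P + invGain lam σ i₁)⁻¹ * invGain lam σ i₁ - 0 := by
      field_simp
      ring
    have hpos : 0 < P / invGain lam σ i₁ := div_pos hP hb1
    refine ⟨fun k => ?_, fun k => ?_, fun k hk => ?_⟩
    · rcases eq_or_ne k i₁ with rfl | hki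
      · simpa using hpos.le
      · simp [hki]
    · rcases eq_or_ne k i₁ with rfl | hki
      · rw [Pi.single_eq_same, hne]
      · rw [Pi.single_eq_of_ne hki, add_zero, inv_one, sub_zero, inv_mul_eq_div,
          one_le_div (by positivity)]
        exact hgap.trans (hle k hki)
    · rcases eq_or_ne k i₁ with rfl | hki
      · rw [Pi.single_eq_same, hne]
      · simp [hki] at hk
  have h1 := hlev.sum_log_le hw.nonneg
  have h2 : ∑ k, invGain lam σ k * (Pi.single i₁ (P / invGain lam σ i₁) : Fin r → ℝ) k = P := by
    rw [Finset.sum_eq_single i₁ (fun k _ hk => by simp [hk]) (by simp), Pi.single_eq_same,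
      mul_div_cancel₀ _ hb1.ne']
  have h3 : ∑ k, Real.log (1 + (Pi.single i₁ (P / invGain lam σ i₁) : Fin r → ℝ) k)
      = Real.log (1 + P / invGain lam σ i₁) := by
    rw [Finset.sum_eq_single i₁ (fun k _ hk => by simp [hk]) (by simp), Pi.single_eq_same]
  rw [h2, h3, sum_invGain_mul h hσ (wfPower lam P σ), hsum, ← rateMax_eq h hr hσ hP] at h1
  have h4 : Real.log (1 + y) ≤ Real.log (1 + P / invGain lam σ i₁) := by
    rw [log_two_rpow]
    have := mul_le_mul_of_nonneg_right hmax hlog2.le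
    linarith
  have h5 := (Real.log_le_log_iff (by positivity) (by positivity)).1 h4
  have h6 : y ≤ P / invGain lam σ i₁ := by linarith
  rw [le_div_iff₀ hb1] at h6
  linarith

/-- For `R > 0` below the threshold, energy beamforming satisfies the first-order conditions. -/
lemma isStationary_beamforming (h : IsReducedSVD H U lam V) (hσ : 0 < σ) (hP : 0 < P) (hR : 0 < R)
    {i₁ i₂ : Fin r} (hle : ∀ k, k ≠ i₁ → lam k ≤ lam i₂) (h12 : lam i₂ ≤ lam i₁)
    (hth : R ≤ rateThreshold (lam i₁) (lam i₂) P σ)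
    (hfit : invGain lam σ i₁ * ((2 : ℝ) ^ R - 1) ≤ P) :
    IsStationary lam P σ R (invGain lam σ i₁ * ((2 : ℝ) ^ R - 1) / P)
      (σ ^ 2 * Real.log 2 * (1 + ((2 : ℝ) ^ R - 1))) (lam i₁ ^ 2)
      (Pi.single i₁ ((2 : ℝ) ^ R - 1)) := by
  have hlog2 := Real.log_pos one_lt_two
  have hb1 := invGain_pos h hσ i₁
  have hl1 := h.pos i₁
  have e1 := sq_mul_invGain (σ := σ) h i₁
  have hlog := log_two_rpow R
  have hy0 : 0 < (2 : ℝ) ^ R - 1 := sub_pos.2 (Real.one_lt_rpow one_lt_two hR)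
  have hkey := (le_rateThreshold_iff_of_mul_eq h hσ hP hR.le h12
    (div_mul_cancel₀ (invGain lam σ i₁ * ((2 : ℝ) ^ R - 1)) hP.ne')).1 hth
  set y := (2 : ℝ) ^ R - 1
  set b₁ := invGain lam σ i₁
  set x := b₁ * y / P with hx
  have hx0 : 0 < x := by positivity
  have hxP : x * P = b₁ * y := div_mul_cancel₀ _ hP.ne'
  have hμ : 0 < σ ^ 2 * Real.log 2 * (1 + y) := by positivity
  have hlev : ∀ k, Real.log 2 * lam i₁ ^ 2 / (x * (σ ^ 2 * Real.log 2 * (1 + y))) *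
      invGain lam σ k - Real.log 2 * σ ^ 2 * (1 - x) / (x * (σ ^ 2 * Real.log 2 * (1 + y)))
      = (lam i₁ ^ 2 - (1 - x) * lam k ^ 2) / (x * (1 + y) * lam k ^ 2) := fun k => by
    rw [level_eq_mul h hx0 hμ]
    have := h.pos k
    field_simp
  have hone : (1 + y)⁻¹ = (lam i₁ ^ 2 - (1 - x) * lam i₁ ^ 2) / (x * (1 + y) * lam i₁ ^ 2) := by
    field_simp
    ring
  refine ⟨hx0, (div_le_one hP).2 hfit, hμ, by positivity, ⟨fun k => ?_, fun k => ?_,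
    fun k hk => ?_⟩, ?_, ?_, ?_⟩
  · rcases eq_or_ne k i₁ with rfl | hki
    · simpa using hy0.le
    · simp [hki]
  · rw [hlev]
    rcases eq_or_ne k i₁ with rfl | hki
    · rw [Pi.single_eq_same, hone]
    · have hlk := h.pos k
      rw [Pi.single_eq_of_ne hki, add_zero, inv_one, one_le_div (by positivity)]
      have hk2 : lam k ^ 2 ≤ lam i₂ ^ 2 := pow_le_pow_left₀ hlk.le (hle k hki) 2
      have h4 : lam k ^ 2 * (1 + x * y) ≤ lam i₂ ^ 2 * (1 + x * y) :=
        mul_le_mul_of_nonneg_right hk2 (by positivity)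
      linarith
  · rw [hlev]
    rcases eq_or_ne k i₁ with rfl | hki
    · rw [Pi.single_eq_same, hone]
    · simp [hki] at hk
  · rw [Finset.sum_eq_single i₁ (fun k _ hk => by simp [hk]) (by simp), Pi.single_eq_same, hlog]
  · rw [Finset.sum_eq_single i₁ (fun k _ hk => by simp [hk]) (by simp), Pi.single_eq_same, hxP]
  · rw [Finset.sum_pi_single', if_pos (Finset.mem_univ _), hxP, ← e1]
    ring

/-- Conversely, a stationary point that leaves the second channel unused is energy beamforming
at a rate below the threshold. -/
lemma IsStationary.le_rateThreshold (h : IsReducedSVD H U lam V) (hσ : 0 < σ) (hP : 0 < P)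
    (hR : 0 < R) {i₁ i₂ : Fin r} (hle : ∀ k, k ≠ i₁ → lam k ≤ lam i₂) (h12 : lam i₂ ≤ lam i₁)
    (hs : IsStationary lam P σ R x μ ν d) (hd : d i₂ = 0) :
    R ≤ rateThreshold (lam i₁) (lam i₂) P σ := by
  have hlog2 := Real.log_pos one_lt_two
  have hx := hs.x_pos
  have hμ := hs.mu_pos
  have hl1 := h.pos i₁
  have hl2 := h.pos i₂
  have hα : 0 ≤ Real.log 2 * ν / (x * μ) :=
    div_nonneg (mul_nonneg hlog2.le hs.nu_pos.le) (mul_nonneg hx.le hμ.le)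
  have h2 := hs.level.le i₂
  rw [hd, add_zero, inv_one] at h2
  have hzero : ∀ k, k ≠ i₁ → d k = 0 := fun k hk => by
    by_contra hdk
    have h3 := hs.level.eq k hdk
    have h4 : (1 + d k)⁻¹ < 1 := inv_lt_one_of_one_lt₀ (by
      linarith [lt_of_le_of_ne (hs.level.nonneg k) (Ne.symm hdk)])
    have h5 : invGain lam σ i₂ ≤ invGain lam σ k :=
      div_le_div_of_nonneg_left (sq_nonneg σ) (pow_pos (h.pos k) 2)
        (pow_le_pow_left₀ (h.pos k).le (hle k hk) 2)
    have h6 := mul_le_mul_of_nonneg_left h5 hα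
    linarith
  have hrate := hs.rate
  have hpow := hs.power
  have hbal := hs.balance
  rw [Finset.sum_eq_single i₁ (fun k _ hk => by simp [hzero k hk]) (by simp)] at hrate hpow hbal
  have hy : d i₁ = (2 : ℝ) ^ R - 1 := by
    rw [← log_two_rpow R] at hrate
    have := Real.log_injOn_pos (by
      have := hs.level.nonneg i₁
      simp only [Set.mem_Ioi]
      linarith) (by simp only [Set.mem_Ioi, add_sub_cancel]; positivity) hrate
    linarith
  have hy0 : 0 < (2 : ℝ) ^ R - 1 := sub_pos.2 (Real.one_lt_rpow one_lt_two hR)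
  rw [le_rateThreshold_iff_of_mul_eq h hσ hP hR.le h12 (by rw [← hy, hpow]), ← hy]
  rw [← hy] at hy0
  have e1 := sq_mul_invGain (σ := σ) h i₁
  have hν : ν = lam i₁ ^ 2 := by
    rw [← hpow, ← e1] at hbal
    have h3 : invGain lam σ i₁ * d i₁ ≠ 0 := (mul_pos (invGain_pos h hσ i₁) hy0).ne'
    refine (mul_right_cancel₀ h3 ?_).symm
    linarith
  have hone := hs.level.eq i₁ hy0.ne'
  rw [level_eq_mul h hx hμ] at h2 hone
  rw [hν] at h2 hone
  have hμeq : μ = Real.log 2 * σ ^ 2 * (1 + d i₁) := by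
    have h3 : 1 + d i₁ ≠ 0 := by linarith
    field_simp at hone
    exact mul_left_cancel₀ hx.ne' (by linear_combination hone)
  have h3 : Real.log 2 * σ ^ 2 / (x * μ * lam i₂ ^ 2) * (lam i₁ ^ 2 - (1 - x) * lam i₂ ^ 2)
      = (lam i₁ ^ 2 - (1 - x) * lam i₂ ^ 2) / (x * (1 + d i₁) * lam i₂ ^ 2) := by
    rw [hμeq]
    have h3 : 1 + d i₁ ≠ 0 := by linarith
    field_simp
  rw [h3, one_le_div (by positivity)] at h2
  linarith

/-- Without a rate constraint only the received power counts; it is largest, and for a simple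
largest singular value only largest, when all the power is sent along the first eigenchannel. -/
lemma isGlobalOptimum_zero_rate (h : IsReducedSVD H U lam V) (hP : 0 < P)
    {i₁ : Fin r} (hle : ∀ k, lam k ≤ lam i₁) :
    IsGlobalOptimum H P σ 0 (covOfPowers V (Pi.single i₁ P)) 1 ∧
      ((∀ k, k ≠ i₁ → lam k < lam i₁) → ∀ (S : Matrix (Fin NT) (Fin NT) ℂ) (ρ : ℝ),
        IsGlobalOptimum H P σ 0 S ρ → S = covOfPowers V (Pi.single i₁ P) ∧ ρ = 1) := by
  have hl1 := h.pos i₁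
  have hp0 : ∀ k, 0 ≤ (Pi.single i₁ P : Fin r → ℝ) k := fun k => by
    rcases eq_or_ne k i₁ with rfl | hki
    · simpa using hP.le
    · simp [hki]
  have hf : Feasible H P σ 0 (covOfPowers V (Pi.single i₁ P)) 1 := by
    refine ⟨?_, ?_, covOfPowers_posSemidef hp0, zero_le_one, le_rfl⟩
    · simp [rate, infoMat]
    · rw [trace_covOfPowers h, Finset.sum_pi_single', if_pos (Finset.mem_univ _)]
  have hval : harvest H (covOfPowers V (Pi.single i₁ P)) 1 = lam i₁ ^ 2 * P := by
    rw [harvest, one_mul, recvPower_covOfPowers h,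
      Finset.sum_eq_single i₁ (fun k _ hk => by simp [hk]) (by simp), Pi.single_eq_same]
  have hterm : ∀ {S : Matrix (Fin NT) (Fin NT) ℂ}, S.PosSemidef → ∀ k,
      lam k ^ 2 * channelPower V S k ≤ lam i₁ ^ 2 * channelPower V S k := fun hS k =>
    mul_le_mul_of_nonneg_right (pow_le_pow_left₀ (h.pos k).le (hle k) 2)
      (channelPower_nonneg hS k)
  have hrecv : ∀ {S : Matrix (Fin NT) (Fin NT) ℂ} {ρ : ℝ}, Feasible H P σ 0 S ρ →
      recvPower H S ≤ lam i₁ ^ 2 * P := fun {S ρ} hS => by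
    rw [recvPower_eq h]
    refine (Finset.sum_le_sum fun k _ => hterm hS.psd k).trans ?_
    rw [← Finset.mul_sum]
    exact mul_le_mul_of_nonneg_left ((sum_channelPower_le h hS.psd).1.trans hS.power_le)
      (sq_nonneg _)
  have hrecv0 : ∀ {S : Matrix (Fin NT) (Fin NT) ℂ}, S.PosSemidef → 0 ≤ recvPower H S :=
    fun hS => by
      rw [recvPower_eq h]
      exact Finset.sum_nonneg fun k _ => mul_nonneg (sq_nonneg _) (channelPower_nonneg hS k)
  refine ⟨⟨hf, fun S ρ hS => ?_⟩, fun hlt S ρ hS => ?_⟩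
  · rw [hval, harvest]
    exact (mul_le_of_le_one_left (hrecv0 hS.psd) hS.ratio_mem.2).trans (hrecv hS)
  · have h1 := hS.2 _ _ hf
    have hS := hS.1
    rw [hval, harvest] at h1
    have h2 := hrecv hS
    have h3 := hS.ratio_mem.2
    have hpos : 0 < lam i₁ ^ 2 * P := by positivity
    have h4 : recvPower H S = lam i₁ ^ 2 * P :=
      le_antisymm h2 (h1.trans (mul_le_of_le_one_left (hrecv0 hS.psd) h3))
    have hρ : ρ = 1 := by
      rw [h4] at h1
      exact le_antisymm h3 (le_of_mul_le_mul_right (by linarith) hpos)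
    have hsum := (sum_channelPower_le h hS.psd)
    have hsumP : ∑ k, channelPower V S k = P := by
      refine le_antisymm (hsum.1.trans hS.power_le) ?_
      have h5 : lam i₁ ^ 2 * P ≤ lam i₁ ^ 2 * ∑ k, channelPower V S k := by
        rw [← h4, recvPower_eq h, Finset.mul_sum]
        exact Finset.sum_le_sum fun k _ => hterm hS.psd k
      exact le_of_mul_le_mul_left h5 (by positivity)
    have hq0 : ∀ k, k ≠ i₁ → channelPower V S k = 0 := by
      have h6 : ∑ k, (lam i₁ ^ 2 * channelPower V S k - lam k ^ 2 * channelPower V S k) = 0 := by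
        rw [Finset.sum_sub_distrib, ← Finset.mul_sum, hsumP, ← recvPower_eq h, h4, sub_self]
      intro k hk
      have h7 := (Finset.sum_eq_zero_iff_of_nonneg
        fun k _ => sub_nonneg.2 (hterm hS.psd k)).1 h6 k (Finset.mem_univ k)
      rw [← sub_mul] at h7
      refine (mul_eq_zero.1 h7).resolve_left (ne_of_gt (sub_pos.2 ?_))
      exact pow_lt_pow_left₀ (hlt k hk) (h.pos k).le two_ne_zero
    have hq1 : channelPower V S i₁ = P := by
      rw [← hsumP, Finset.sum_eq_single i₁ (fun k _ hk => hq0 k hk) (by simp)]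
    have hQ := hS.psd.conjTranspose_mul_mul_same V
    have him : ∀ k, (Vᴴ * S * V) k k = (channelPower V S k : ℂ) := fun k =>
      Complex.ext rfl (by simpa using (Complex.nonneg_iff.1 (hQ.diag_nonneg (i := k))).2.symm)
    -- a positive semidefinite matrix vanishes on the columns with zero diagonal
    have hcol : ∀ j k, k ≠ i₁ → (Vᴴ * S * V) j k = 0 := fun j k hk => by
      have h8 : star (Pi.single k (1 : ℂ)) ⬝ᵥ ((Vᴴ * S * V) *ᵥ Pi.single k 1) = 0 := by
        rw [Matrix.mulVec_single_one, ← Pi.single_star, star_one, single_one_dotProduct,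
          Matrix.col_apply, him, hq0 k hk, Complex.ofReal_zero]
      have h9 := congrFun ((hQ.dotProduct_mulVec_zero_iff _).1 h8) j
      rwa [Matrix.mulVec_single_one] at h9
    have hdiag : Vᴴ * S * V = Matrix.diagonal fun k => ((Pi.single i₁ P : Fin r → ℝ) k : ℂ) := by
      ext j k
      rcases eq_or_ne k i₁ with rfl | hk
      · rcases eq_or_ne j k with rfl | hj
        · rw [Matrix.diagonal_apply_eq, him, hq1, Pi.single_eq_same]
        · rw [Matrix.diagonal_apply_ne _ hj, ← hQ.1.apply, hcol k j hj, star_zero]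
      · rw [hcol j k hk]
        rcases eq_or_ne j k with rfl | hj
        · simp [hk]
        · rw [Matrix.diagonal_apply_ne _ hj]
    refine ⟨?_, hρ⟩
    rw [hsum.2 (by rw [hsumP]; exact hS.power_le), hdiag, covOfPowers]

/-- The KKT conditions at energy beamforming, for every splitting `x` that makes the rate
constraint tight. -/
lemma isKKTPoint_beamforming_iff (h : IsReducedSVD H U lam V) (hσ : 0 < σ) (hP : 0 < P)
    {i₁ i₂ : Fin r} (hle : ∀ k, k ≠ i₁ → lam k ≤ lam i₂) {y : ℝ} (hy : 0 ≤ y)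
    (hx0 : 0 ≤ x) (hxy : x * P = invGain lam σ i₁ * y)
    (hkey : lam i₂ ^ 2 * (1 + x * y) ≤ lam i₁ ^ 2) (hlog : Real.log (1 + y) = R * Real.log 2)
    (hf : Feasible H P σ R (covOfPowers V (Pi.single i₁ P)) (1 - x)) (μ ν : ℝ) :
    IsKKTPoint H P σ R (covOfPowers V (Pi.single i₁ P)) (1 - x) μ ν ↔
      μ = σ ^ 2 * Real.log 2 * (1 + y) ∧ ν = lam i₁ ^ 2 := by
  have hlog2 := Real.log_pos one_lt_two
  have hl1 := h.pos i₁
  have hb1 := invGain_pos h hσ i₁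
  have hρ : 1 - x ≤ 1 := by linarith
  have hp0 : ∀ k, 0 ≤ (Pi.single i₁ P : Fin r → ℝ) k := fun k => by
    rcases eq_or_ne k i₁ with rfl | hki
    · simpa using hP.le
    · simp [hki]
  have hsnr : (1 - (1 - x)) * (Pi.single i₁ P : Fin r → ℝ) i₁ / invGain lam σ i₁ = y := by
    rw [sub_sub_cancel, Pi.single_eq_same, hxy, mul_div_cancel_left₀ _ hb1.ne']
  have hsnr0 : ∀ k, k ≠ i₁ →
      (1 - (1 - x)) * (Pi.single i₁ P : Fin r → ℝ) k / invGain lam σ k = 0 := fun k hk => by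
    simp [hk]
  have hrecv : recvPower H (covOfPowers V (Pi.single i₁ P)) = lam i₁ ^ 2 * P := by
    rw [recvPower_covOfPowers h,
      Finset.sum_eq_single i₁ (fun k _ hk => by simp [hk]) (by simp), Pi.single_eq_same]
  have hslope : rateSlope H σ (covOfPowers V (Pi.single i₁ P)) (1 - x)
      = lam i₁ ^ 2 * P / (σ ^ 2 * Real.log 2 * (1 + y)) := by
    rw [rateSlope_covOfPowers h hp0 hρ,
      Finset.sum_eq_single i₁ (fun k _ hk => by simp [hk]) (by simp), hsnr, Pi.single_eq_same]
    field_simp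
  have hg1 : channelGrad lam σ (Pi.single i₁ P) (1 - x) (σ ^ 2 * Real.log 2 * (1 + y)) i₁
      = lam i₁ ^ 2 := by
    rw [channelGrad, hsnr]
    field_simp
    ring
  have hpi : (Pi.single i₁ P : Fin r → ℝ) i₁ ≠ 0 := by
    rw [Pi.single_eq_same]
    exact hP.ne'
  constructor
  · intro hk
    have h1 := hk.stat_ρ
    rw [hrecv, hslope] at h1
    have hμ : μ = σ ^ 2 * Real.log 2 * (1 + y) := by
      field_simp at h1
      have := (mul_eq_zero.1 (h1.trans (mul_zero _))).resolve_left (by positivity)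
      linarith
    refine ⟨hμ, ?_⟩
    have h2 := hk.channelGrad_eq h hp0 hpi
    rw [← h2, hμ, hg1]
  · rintro ⟨rfl, rfl⟩
    refine isKKTPoint_covOfPowers h hp0 hf (by positivity) (by positivity) (fun k => ?_)
      (fun k hk => ?_) ?_ ?_ ?_
    · rcases eq_or_ne k i₁ with rfl | hki
      · rw [hg1]
      · have h3 : channelGrad lam σ (Pi.single i₁ P) (1 - x) (σ ^ 2 * Real.log 2 * (1 + y)) k
            = lam k ^ 2 * (1 + x * y) := by
          rw [channelGrad, hsnr0 k hki]
          field_simp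
          ring
        rw [h3]
        refine le_trans (mul_le_mul_of_nonneg_right ?_ (by positivity)) hkey
        exact pow_le_pow_left₀ (h.pos k).le (hle k hki) 2
    · rcases eq_or_ne k i₁ with rfl | hki
      · exact hg1
      · simp [hki] at hk
    · rw [hrecv, hslope]
      field_simp
    · have h4 := rate_covOfPowers h hp0 (σ := σ) hρ
      rw [Finset.sum_eq_single i₁ (fun k _ hk => by rw [hsnr0 k hk]; simp) (by simp), hsnr,
        hlog] at h4
      exact mul_right_cancel₀ hlog2.ne' h4
    · rw [Finset.sum_pi_single', if_pos (Finset.mem_univ _)]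

end Beamforming

end SWIPT

/-! ### The optimal transmission strategy -/

theorem mainTheorem2 {NR NT r : ℕ} (hr : 2 ≤ r)
    (H : Matrix (Fin NR) (Fin NT) ℂ) (U : Matrix (Fin NR) (Fin r) ℂ) (lam : Fin r → ℝ)
    (V : Matrix (Fin NT) (Fin r) ℂ) (hsvd : IsReducedSVD H U lam V)
    (P σ R : ℝ) (hP : 0 < P) (hσ : 0 < σ) (hR : 0 ≤ R)
    (i₁ i₂ : Fin r) (hi₁ : (i₁ : ℕ) = 0) (hi₂ : (i₂ : ℕ) = 1) :
    -- energy beamforming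
    (R ≤ rateThreshold (lam i₁) (lam i₂) P σ → R ≤ rateMax H lam V P σ →
      IsGlobalOptimum H P σ R (covEB (V.col i₁) P) (ratioEB (lam i₁) P σ R) ∧
      (∀ μ ν : ℝ,
        IsKKTPoint H P σ R (covEB (V.col i₁) P) (ratioEB (lam i₁) P σ R) μ ν ↔
          μ = muEB (lam i₁) P σ R ∧ ν = nuEB (lam i₁) P σ R) ∧
      (lam i₂ < lam i₁ → ∀ (S : Matrix (Fin NT) (Fin NT) ℂ) (ρ : ℝ),
        IsGlobalOptimum H P σ R S ρ →
          S = covEB (V.col i₁) P ∧ ρ = ratioEB (lam i₁) P σ R)) ∧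
    -- spatial multiplexing
    (rateThreshold (lam i₁) (lam i₂) P σ < R → R ≤ rateMax H lam V P σ →
      ∃ ρ μ ν : ℝ,
        SolvesSystem H lam V P σ R ρ μ ν ∧
        (∀ ρ' μ' ν' : ℝ, SolvesSystem H lam V P σ R ρ' μ' ν' → ρ' = ρ ∧ μ' = μ ∧ ν' = ν) ∧
        IsGlobalOptimum H P σ R (covSM lam V σ ρ μ ν) ρ ∧
        (∀ (S : Matrix (Fin NT) (Fin NT) ℂ) (ρ' : ℝ),
          IsGlobalOptimum H P σ R S ρ' → S = covSM lam V σ ρ μ ν ∧ ρ' = ρ) ∧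
        IsKKTPoint H P σ R (covSM lam V σ ρ μ ν) ρ μ ν ∧
        0 < powerSM lam σ ρ μ ν i₂) ∧
    -- infeasibility
    (rateMax H lam V P σ < R →
      ¬ ∃ (S : Matrix (Fin NT) (Fin NT) ℂ) (ρ : ℝ), Feasible H P σ R S ρ) := by
  have hr0 : 0 < r := by omega
  have hfirst : ∀ k, lam k ≤ lam i₁ := fun k => hsvd.anti (Fin.le_def.2 (by omega))
  have hsecond : ∀ k, k ≠ i₁ → lam k ≤ lam i₂ := fun k hk => hsvd.anti (Fin.le_def.2 (by
    have : (k : ℕ) ≠ i₁ := fun h => hk (Fin.ext h)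
    omega))
  have h12 := hfirst i₂
  have hb := invGain_pos hsvd hσ
  have hlog2 := Real.log_pos one_lt_two
  refine ⟨fun hth hmax => ?_, fun hth hmax => ?_, ?_⟩
  · have hfit := invGain_mul_le_of_le hsvd hσ hP hR (fun k hk =>
      div_le_div_of_nonneg_left (sq_nonneg σ) (pow_pos (hsvd.pos k) 2)
        (pow_le_pow_left₀ (hsvd.pos k).le (hsecond k hk) 2)) h12 hth hmax
    have hy0 : 0 ≤ (2 : ℝ) ^ R - 1 := sub_nonneg.2 (Real.one_le_rpow one_le_two hR)
    have hl1 := hsvd.pos i₁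
    have hb1 := hb i₁
    have e1 := sq_mul_invGain (σ := σ) hsvd i₁
    have hlog := log_two_rpow R
    obtain ⟨x, hx⟩ : ∃ x, x = invGain lam σ i₁ * ((2 : ℝ) ^ R - 1) / P := ⟨_, rfl⟩
    have hx0 : 0 ≤ x := by
      rw [hx]
      exact div_nonneg (mul_nonneg hb1.le hy0) hP.le
    have hx1 : x ≤ 1 := by
      rw [hx]
      exact (div_le_one hP).2 hfit
    have hxP : x * P = invGain lam σ i₁ * ((2 : ℝ) ^ R - 1) := by
      rw [hx, div_mul_cancel₀ _ hP.ne']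
    have hρ : ratioEB (lam i₁) P σ R = 1 - x := by
      have : ((2 : ℝ) ^ R - 1) * σ ^ 2 / (P * lam i₁ ^ 2) = x := by
        rw [hx, invGain]
        field_simp
      rw [ratioEB, this, max_eq_right (by linarith)]
    have hμ : muEB (lam i₁) P σ R = σ ^ 2 * Real.log 2 * (1 + ((2 : ℝ) ^ R - 1)) := by
      rw [muEB, hρ]
      congr 2
      rw [sub_sub_cancel, hxP, div_eq_iff (by positivity), ← e1]
      ring
    have hν : nuEB (lam i₁) P σ R = lam i₁ ^ 2 := by
      have h1 : σ ^ 2 + (1 - (1 - x)) * P * lam i₁ ^ 2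
          = σ ^ 2 * (1 + ((2 : ℝ) ^ R - 1)) := by
        linear_combination lam i₁ ^ 2 * hxP + ((2 : ℝ) ^ R - 1) * e1
      rw [nuEB, hμ, hρ, h1]
      generalize (2 : ℝ) ^ R - 1 = y at hy0
      field_simp
      ring
    have hkey := (le_rateThreshold_iff_of_mul_eq hsvd hσ hP hR h12 hxP).1 hth
    rw [covEB_eq, hρ, hμ, hν]
    have hopt : IsGlobalOptimum H P σ R (covOfPowers V (Pi.single i₁ P)) (1 - x) ∧
        (lam i₂ < lam i₁ → ∀ (S : Matrix (Fin NT) (Fin NT) ℂ) (ρ : ℝ),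
          IsGlobalOptimum H P σ R S ρ →
            S = covOfPowers V (Pi.single i₁ P) ∧ ρ = 1 - x) := by
      rcases hR.eq_or_lt with h0 | hR
      · -- without a rate to sustain, everything is harvested
        subst h0
        have hx0 : x = 0 := by simp [hx]
        rw [hx0, sub_zero]
        obtain ⟨h1, h2⟩ := isGlobalOptimum_zero_rate (σ := σ) hsvd hP hfirst
        exact ⟨h1, fun hlt => h2 fun k hk => (hsecond k hk).trans_lt hlt⟩
      · have hs := isStationary_beamforming hsvd hσ hP hR hsecond h12 hth hfit
        rw [← hx] at hs
        obtain ⟨h1, h2⟩ := hs.isGlobalOptimum_unique (p := Pi.single i₁ P) hsvd hσ hP hR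
          fun k => by
            rcases eq_or_ne k i₁ with rfl | hk
            · rw [Pi.single_eq_same, Pi.single_eq_same, hxP]
            · simp [hk]
        exact ⟨h1, fun _ => h2⟩
    exact ⟨hopt.1, isKKTPoint_beamforming_iff hsvd hσ hP hsecond hy0 hx0 hxP hkey hlog
      hopt.1.1, hopt.2⟩
  · have hth0 : 0 ≤ rateThreshold (lam i₁) (lam i₂) P σ := by
      rw [le_rateThreshold_iff (hsvd.pos i₂) h12 hP hσ le_rfl]
      simp only [Real.rpow_zero, sub_self, ne_eq, OfNat.ofNat_ne_zero, not_false_eq_true,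
        zero_pow, zero_mul]
      exact mul_nonneg (by positivity)
        (sub_nonneg.2 (pow_le_pow_left₀ (hsvd.pos i₂).le h12 2))
    have hR0 := hth0.trans_lt hth
    obtain ⟨x, μ, ν, d, hs⟩ := exists_isStationary hsvd hr0 hσ hP hR0 hmax
    have hp := hs.mul_powerSM hsvd hσ
    obtain ⟨hopt, huniq⟩ := hs.isGlobalOptimum_unique hsvd hσ hP hR0 hp
    have hp2 : 0 < powerSM lam σ (1 - x) μ ν i₂ := by
      refine lt_of_le_of_ne (le_max_left _ _) fun h0 => ?_
      have h1 := hp i₂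
      rw [← h0, mul_zero] at h1
      exact absurd (hs.le_rateThreshold hsvd hσ hP hR0 hsecond h12
        ((mul_eq_zero.1 h1.symm).resolve_left (hb i₂).ne')) (not_le.2 hth)
    refine ⟨1 - x, μ, ν, hs.solvesSystem hsvd hσ hP, fun ρ' μ' ν' hs' => ?_, hopt, huniq,
      hs.isKKTPoint hsvd hσ hp, hp2⟩
    -- another solution is optimal as well, so it has the same covariance and the same `ρ`
    obtain ⟨d', hd'⟩ := hs'.exists_isStationary hsvd hσ
    have hp' := hd'.mul_powerSM hsvd hσ
    obtain ⟨hcov, hρ⟩ := huniq _ _ (hd'.isGlobalOptimum_unique hsvd hσ hP hR0 hp').1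
    rw [sub_sub_cancel] at hcov hρ
    subst hρ
    have hμ : μ' = μ := by
      have h1 := hs'.stat_ρ
      have h2 := (hs.solvesSystem hsvd hσ hP).stat_ρ
      rw [covSM, hcov] at h1
      exact h1.trans h2.symm
    subst hμ
    refine ⟨rfl, rfl, ?_⟩
    -- the water level of the second channel, which is in use, determines `ν`
    have hpow : powerSM lam σ (1 - x) μ' ν' i₂ = powerSM lam σ (1 - x) μ' ν i₂ := by
      have h1 := congrArg (fun S => channelPower V S i₂) hcov
      simpa only [channelPower_covOfPowers hsvd] using h1
    have hval : ∀ {ν₀ : ℝ}, 0 < powerSM lam σ (1 - x) μ' ν₀ i₂ →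
        powerSM lam σ (1 - x) μ' ν₀ i₂ = μ' / (Real.log 2 * (ν₀ - (1 - x) * lam i₂ ^ 2))
          - σ ^ 2 / ((1 - (1 - x)) * lam i₂ ^ 2) := fun {ν₀} h0 => by
      rw [powerSM] at h0 ⊢
      exact max_eq_right (by
        by_contra hc
        rw [max_eq_left (not_le.1 hc).le] at h0
        exact lt_irrefl _ h0)
    have h1 := hval hp2
    have h2 := hval (hpow ▸ hp2)
    rw [hpow, h1, sub_left_inj, div_eq_div_iff
      (mul_pos hlog2 (sub_pos.2 (hs.level_pos hsvd hσ i₂))).ne'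
      (mul_pos hlog2 (sub_pos.2 (hs'.level_pos i₂))).ne'] at h2
    have h3 := mul_left_cancel₀ hlog2.ne' (mul_left_cancel₀ hs'.mu_pos.ne' h2)
    linarith
  · rintro hlt ⟨S, ρ, hf⟩
    exact absurd (hf.le_rateMax hsvd hr0 hσ hP) (not_le.2 hlt)
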